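/- **Theorem.** Let $\mathcal X$ be a finite alphabet, $\mathcal Y$ a (measurable) reconstruction alphabet, and $d:\mathcal X\times\mathcal Y\to[0,d_{\max}]$ a bounded distortion measure (measurable in its second argument) such that for every $x\in\mathcal X$ there is $y\in\mathcal Y$ with $d(x,y)=0$. For sequences put $d^{(n)}(x^n,y^n)=\frac1n\sum_{i=1}^n d(x_i,y_i)$. Let $\mathsf P$ be a probability distribution on $\mathcal X$, let $X^n=(X_1,\dots,X_n)$ be i.i.d. with law $\mathsf P$, and let $D\ge 0$. A strategy $\mathcal S^{(n)}=\{y^n(1),y^n(2),\dots\}$ is a finite or infinite ordered set of (distinct) sequences in $\mathcal Y^n$; its counting function $G^{(n)}(x^n)$ is the smallest index $j\ge 1$ with $d^{(n)}(x^n,y^n(j))\le D$, and $G^{(n)}(x^n)=\infty$ if there is no such $j$. Define the deception exponent $$E(D)=\liminf_{n\to\infty}\frac1n\,\min_{\mathcal S^{(n)}}\log\mathbb E_{\mathsf P}\big[G^{(n)}(X^n)\big].$$ For a probability distribution $\mathsf Q$ on $\mathcal X$ let $$R(D,\mathsf Q)=\inf_{W:\ \mathbb E[d(X,Y)]\le D}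 I(X;Y)$$ be the rate-distortion function, where the infimum is over all channels (conditional distributions) $W$ from $\mathcal X$ to $\mathcal Y$, $X$ has law $\mathsf Q$, and $Y$ is the output of $W$ for input $X$ (for finite $\mathcal Y$ the infimum is a minimum). Let $D(\mathsf Q\|\mathsf P)\in[0,\infty]$ be the relative entropy; all logarithms are natural. Then $$E(D)=\max_{\mathsf Q}\big[R(D,\mathsf Q)-D(\mathsf Q\|\mathsf P)\big],$$ where $\mathsf Q$ ranges over all probability distributions on $\mathcal X$ and the maximum is attained. -/

import Mathlib

open MeasureTheory ProbabilityTheory InformationTheory Filter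
open scoped ENNReal

namespace Guessing

noncomputable section

/-- Component-wise mean distortion `d⁽ⁿ⁾(xⁿ, yⁿ) = (1/n) ∑ᵢ d(xᵢ, yᵢ)`. -/
def meanDistortion {X Y : Type*} (d : X → Y → ℝ) {n : ℕ} (x : Fin n → X) (y : Fin n → Y) : ℝ :=
  (1 / (n : ℝ)) * ∑ i, d (x i) (y i)

/-- A guessing strategy for block length `n`: an ordered set of guesses in `Yⁿ`, that is, a finite
or infinite list of pairwise distinct sequences. -/
structure Strategy (Y : Type*) (n : ℕ) where
  /-- the list of guesses, in the order in which they are presented -/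
  guesses : Stream'.Seq (Fin n → Y)
  /-- no guess is listed twice -/
  distinct : ∀ i j y, guesses.get? i = some y → guesses.get? j = some y → i = j

/-- The counting function: the index (starting from `1`) of the first guess within distortion `D`
of `x`, and `∞` if there is none (the infimum over the empty set is `⊤`). -/
def guessCount {X Y : Type*} (d : X → Y → ℝ) (D : ℝ) {n : ℕ} (S : Strategy Y n)
    (x : Fin n → X) : ℕ∞ :=
  ⨅ (j : ℕ) (_ : ∃ y, S.guesses.get? j = some y ∧ meanDistortion d x y ≤ D), ((j + 1 : ℕ) : ℕ∞)

/-- The expected number of guesses when `Xⁿ` is i.i.d. with law `P`. -/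
def expectedGuesses {X Y : Type*} [MeasurableSpace X] (P : ProbabilityMeasure X)
    (d : X → Y → ℝ) (D : ℝ) {n : ℕ} (S : Strategy Y n) : ℝ≥0∞ :=
  ∫⁻ x, (guessCount d D S x : ℝ≥0∞) ∂(Measure.pi fun _ : Fin n => (P : Measure X))

/-- The deception exponent
`E(D) = liminf_n (1/n) min_S log 𝔼_P[G⁽ⁿ⁾(Xⁿ)]` (natural logarithm). -/
def deceptionExponent {X Y : Type*} [MeasurableSpace X] (P : ProbabilityMeasure X)
    (d : X → Y → ℝ) (D : ℝ) : EReal :=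
  liminf (fun n : ℕ =>
    (⨅ S : Strategy Y n, ENNReal.log (expectedGuesses P d D S)) / (n : EReal)) atTop

/-- The mutual information `I(X;Y)` (in nats) when `X` has law `Q` and `Y` is obtained from `X`
through the channel `W`: the relative entropy between the joint law and the product of its
marginals. -/
def mutualInfo {X Y : Type*} [MeasurableSpace X] [MeasurableSpace Y]
    (Q : ProbabilityMeasure X) (W : Kernel X Y) : ℝ≥0∞ :=
  klDiv ((Q : Measure X) ⊗ₘ W) ((Q : Measure X).prod (W ∘ₘ (Q : Measure X)))

/-- The channels from `X` to `Y` whose expected distortion under the input law `Q` is at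
most `D`. -/
def admissibleChannels {X Y : Type*} [MeasurableSpace X] [MeasurableSpace Y]
    (d : X → Y → ℝ) (D : ℝ) (Q : ProbabilityMeasure X) : Set (Kernel X Y) :=
  {W | IsMarkovKernel W ∧ ∫ p, d p.1 p.2 ∂((Q : Measure X) ⊗ₘ W) ≤ D}

/-- The rate-distortion function `R(D, Q)`: the least mutual information of an admissible
channel. -/
def rateDistortion {X Y : Type*} [MeasurableSpace X] [MeasurableSpace Y]
    (d : X → Y → ℝ) (D : ℝ) (Q : ProbabilityMeasure X) : ℝ≥0∞ :=
  ⨅ W ∈ admissibleChannels d D Q, mutualInfo Q W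

end

end Guessing

/-!
The exponent is the maximum of `R(D, Q) - D(Q‖P)` because a source of law `P` produces sequences
of empirical distribution near `Q` with probability about `exp (-n D(Q‖P))`, and these sequences
take about `exp (n R(D, Q))` guesses.

All information quantities enter through one device: if the channel laws satisfy
`V x ≤ exp (g x) · ν` for a common reference law `ν`, on any auxiliary alphabet mapped to `Y`, then
the mean of `g` bounds `R(D, Q)` (`rateDistortion_le_of_density_le`); and near-optimal channels come
with such a bounded `g` (`exists_bounded_density`). The auxiliary alphabet makes time sharing
available without convexity arguments.

Lower bound. For a fixed strategy and a law `Q ≪ P`, let `G` be the counting function. It determines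
a reproduction of `Xⁿ` within distortion `D`, so by the chain rule its description under `Qⁿ` costs
at least `n R(D, Q)` nats (`rateDistortion_le_codeLength`); describing the number `G` costs at most
`log G + O(log n)` nats. Hence `n R(D, Q) ≤ E_Q[log G] + O(log n)`, and Jensen's inequality gives
`E_Q[log G] ≤ log E_P[G] + n D(Q‖P)` (`prodMean_log_le`). There is no continuity argument in `D`,
so `D = 0` is not special.

Upper bound. Guesses drawn from the product of the reference law of a near-optimal channel for `Q`
hit the ball around any sequence whose type is near `Q` with probability about `exp (-n R(D, Q))`
(`TestChannel.le_measure_distortionBall`). A small admixture of the error-free channel leaves some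
room in the distortion constraint if `D > 0`; if `D = 0`, the distortion vanishes almost surely and
no room is needed (`exists_testChannel`). By compactness, a mixture of finitely many such
laws serves all types, random guesses are replaced by a fixed list
(`exists_strategy_expectedGuesses_le`), and Chernoff's bound gives the probability of each
neighbourhood of types (`exists_halfspace_prob_le`). Finally `R(D, ·)` is upper semicontinuous and
`D(·‖P)` is continuous on the laws `Q ≪ P`, so the maximum is attained
(`upperSemicontinuousOn_exponentAt`).
-/

namespace Guessing

noncomputable section

/-! ### Densities of a channel with respect to its output law -/

section Channels

lemma channel_density_le {X : Type*} [Fintype X] {q h : X → ℝ} (hq : ∀ x, 0 ≤ q x)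
    (hh : ∀ x, 0 ≤ h x)
    (hs : ∑ x, q x * h x ≤ 1) {x : X} (hx : q x ≠ 0) : h x ≤ 1 / q x := by
  have h1 : q x * h x ≤ 1 :=
    (Finset.single_le_sum (f := fun x => q x * h x) (fun x _ => mul_nonneg (hq x) (hh x))
      (Finset.mem_univ x)).trans hs
  rw [le_div_iff₀ (lt_of_le_of_ne (hq x) (Ne.symm hx))]
  linarith

variable {X Y : Type*} [MeasurableSpace X] [MeasurableSpace Y]

/-- The probability that `Q` gives to the letter `x`, as a real number. -/
def mass (Q : ProbabilityMeasure X) (x : X) : ℝ := (Q : Measure X).real {x}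

lemma mass_nonneg (Q : ProbabilityMeasure X) (x : X) : 0 ≤ mass Q x := measureReal_nonneg

lemma ofReal_mass (Q : ProbabilityMeasure X) (x : X) :
    ENNReal.ofReal (mass Q x) = (Q : Measure X) {x} := by
  simp [mass, Measure.real]

variable [Fintype X] [MeasurableSingletonClass X]

lemma sum_mass (Q : ProbabilityMeasure X) : ∑ x, mass Q x = 1 := by
  have h := integral_fintype (μ := (Q : Measure X)) (f := fun _ => (1 : ℝ)) Integrable.of_finite
  simpa [mass] using h.symm

lemma lintegral_eq_sum_mass (Q : ProbabilityMeasure X) (f : X → ℝ≥0∞) :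
    ∫⁻ x, f x ∂(Q : Measure X) = ∑ x, ENNReal.ofReal (mass Q x) * f x := by
  rw [lintegral_fintype]
  exact Finset.sum_congr rfl fun x _ => by rw [ofReal_mass, mul_comm]

lemma integral_eq_sum_mass (Q : ProbabilityMeasure X) (f : X → ℝ) :
    ∫ x, f x ∂(Q : Measure X) = ∑ x, mass Q x * f x := by
  rw [integral_fintype Integrable.of_finite]
  rfl

lemma comp_apply_eq_sum (Q : ProbabilityMeasure X) (W : Kernel X Y) {s : Set Y}
    (hs : MeasurableSet s) :
    (W ∘ₘ (Q : Measure X)) s = ∑ x, ENNReal.ofReal (mass Q x) * W x s := by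
  rw [Measure.bind_apply hs W.aemeasurable, lintegral_eq_sum_mass]

/-- Every channel law `W x` with `Q x ≠ 0` has a density with respect to the output law, and the
densities can be chosen so that their `Q`-average is at most `1` at every point (not just almost
everywhere), which makes them bounded. -/
lemma exists_channel_density (Q : ProbabilityMeasure X) (W : Kernel X Y) [IsMarkovKernel W] :
    ∃ h : X → Y → ℝ, (∀ x, Measurable (h x)) ∧ (∀ x y, 0 ≤ h x y) ∧
      (∀ y, ∑ x, mass Q x * h x y ≤ 1) ∧
      ∀ x, mass Q x ≠ 0 →
        W x = (W ∘ₘ (Q : Measure X)).withDensity fun y => ENNReal.ofReal (h x y) := by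
  classical
  set μ := W ∘ₘ (Q : Measure X) with hμ
  have hac : ∀ x, mass Q x ≠ 0 → W x ≪ μ := by
    intro x hx
    refine Measure.AbsolutelyContinuous.mk fun s hs h0 => ?_
    rw [hμ, comp_apply_eq_sum Q W hs, Finset.sum_eq_zero_iff] at h0
    have := h0 x (Finset.mem_univ _)
    rw [mul_eq_zero, ENNReal.ofReal_eq_zero] at this
    rcases this with h | h
    · exact absurd (le_antisymm h (mass_nonneg Q x)) hx
    · exact h
  set r : X → Y → ℝ≥0∞ := fun x => (W x).rnDeriv μ with hr
  have hrm : ∀ x, Measurable (r x) := fun x => Measure.measurable_rnDeriv _ _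
  set F : Y → ℝ≥0∞ := fun y => ∑ x, ENNReal.ofReal (mass Q x) * r x y with hF
  have hFm : Measurable F := by fun_prop
  have hae : F ≤ᵐ[μ] fun _ => 1 := by
    refine ae_le_of_forall_setLIntegral_le_of_sigmaFinite hFm fun s hs _ => ?_
    rw [lintegral_finsetSum _ (fun x _ => (hrm x).const_mul _), setLIntegral_one, hμ,
      comp_apply_eq_sum Q W hs]
    refine Finset.sum_le_sum fun x _ => ?_
    rw [lintegral_const_mul _ (hrm x)]
    gcongr
    exact Measure.setLIntegral_rnDeriv_le s
  have hG : MeasurableSet {y | F y ≤ 1} := measurableSet_le hFm measurable_const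
  refine ⟨fun x y => if mass Q x ≠ 0 ∧ F y ≤ 1 then (r x y).toReal else 0, fun x => ?_,
    fun x y => ?_, fun y => ?_, fun x hx => ?_⟩
  · by_cases hx : mass Q x = 0
    · simp [hx]
    · simpa [hx] using Measurable.ite hG (hrm x).ennreal_toReal measurable_const
  · dsimp only
    split_ifs <;> positivity
  · by_cases hy : F y ≤ 1
    · have h1 : ∀ x, mass Q x * (if mass Q x ≠ 0 ∧ F y ≤ 1 then (r x y).toReal else 0)
          = (ENNReal.ofReal (mass Q x) * r x y).toReal := by
        intro x
        by_cases hx : mass Q x = 0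
        · simp [hx]
        · simp [hx, hy, ENNReal.toReal_mul, ENNReal.toReal_ofReal (mass_nonneg Q x)]
      rw [Finset.sum_congr rfl fun x _ => h1 x, ← ENNReal.toReal_sum]
      · exact ENNReal.toReal_le_of_le_ofReal zero_le_one (by simpa using hy)
      · intro x hx
        exact ne_top_of_le_ne_top ENNReal.one_ne_top
          ((Finset.single_le_sum (f := fun x => ENNReal.ofReal (mass Q x) * r x y)
            (fun _ _ => zero_le) hx).trans hy)
    · simp [hy]
  · rw [← Measure.withDensity_rnDeriv_eq (W x) μ (hac x hx)]
    refine withDensity_congr_ae ?_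
    filter_upwards [hae, Measure.rnDeriv_lt_top (W x) μ] with y hy hlt
    simp only [ne_eq, hx, not_false_eq_true, hy, and_self, if_true, hr]
    exact (ENNReal.ofReal_toReal hlt.ne).symm

end Channels

/-! ### A formula for the mutual information -/

section MutualInformation

variable {X Y : Type*} [MeasurableSpace X] [MeasurableSpace Y] [Fintype X]
  [MeasurableSingletonClass X]

lemma integrable_of_bounded {Z : Type*} [MeasurableSpace Z] {ν : Measure Z} [IsFiniteMeasure ν]
    {f : Z → ℝ} (hf : Measurable f) {C : ℝ} (hC : ∀ z, |f z| ≤ C) : Integrable f ν :=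
  Integrable.of_bound hf.aestronglyMeasurable C (ae_of_all _ hC)

lemma exists_bound_of_continuous {Z : Type*} {h : Z → ℝ} {C : ℝ} (h0 : ∀ z, 0 ≤ h z)
    (hC : ∀ z, h z ≤ C) {φ : ℝ → ℝ} (hφ : Continuous φ) : ∃ B, ∀ z, |φ (h z)| ≤ B := by
  obtain ⟨B, hB⟩ := (isCompact_Icc (a := (0 : ℝ)) (b := C)).exists_bound_of_continuousOn
    hφ.continuousOn
  exact ⟨B, fun z => hB _ ⟨h0 z, hC z⟩⟩

lemma integral_density_eq_one {μ ρ : Measure Y} [IsProbabilityMeasure ρ] {h : Y → ℝ}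
    (hm : Measurable h) (h0 : ∀ y, 0 ≤ h y)
    (hρ : ρ = μ.withDensity fun y => ENNReal.ofReal (h y)) : ∫ y, h y ∂μ = 1 := by
  rw [integral_eq_lintegral_of_nonneg_ae (ae_of_all _ h0) hm.aestronglyMeasurable]
  have : ρ Set.univ = 1 := measure_univ
  rw [hρ, withDensity_apply _ MeasurableSet.univ, setLIntegral_univ] at this
  simp [this]

lemma integral_withDensity_ofReal {μ : Measure Y} {h : Y → ℝ} (hm : Measurable h)
    (h0 : ∀ y, 0 ≤ h y) (f : Y → ℝ) :
    ∫ y, f y ∂(μ.withDensity fun y => ENNReal.ofReal (h y)) = ∫ y, h y * f y ∂μ := by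
  rw [integral_withDensity_eq_integral_toReal_smul hm.ennreal_ofReal
    (ae_of_all _ fun _ => ENNReal.ofReal_lt_top)]
  simp [ENNReal.toReal_ofReal, h0]

/-- The mutual information in terms of densities of the channel laws with respect to the output
law. In particular it is finite for every channel with finite input alphabet. -/
lemma mutualInfo_eq (Q : ProbabilityMeasure X) (W : Kernel X Y) [IsMarkovKernel W] {h : X → Y → ℝ}
    (hm : ∀ x, Measurable (h x)) (h0 : ∀ x y, 0 ≤ h x y) (hs : ∀ y, ∑ x, mass Q x * h x y ≤ 1)
    (hW : ∀ x, mass Q x ≠ 0 →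
      W x = (W ∘ₘ (Q : Measure X)).withDensity fun y => ENNReal.ofReal (h x y)) :
    mutualInfo Q W = ENNReal.ofReal
      (∑ x, mass Q x * ∫ y, h x y * Real.log (h x y) ∂(W ∘ₘ (Q : Measure X))) := by
  set μ := W ∘ₘ (Q : Measure X) with hμ
  have hm2 : Measurable fun p : X × Y => h p.1 p.2 :=
    measurable_from_prod_countable_right hm
  have hJ : (Q : Measure X) ⊗ₘ W
      = ((Q : Measure X).prod μ).withDensity fun p => ENNReal.ofReal (h p.1 p.2) := by
    ext s hs
    rw [Measure.compProd_apply hs, withDensity_apply _ hs, ← lintegral_indicator hs,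
      lintegral_prod _ ((hm2.ennreal_ofReal.indicator hs).aemeasurable), lintegral_eq_sum_mass,
      lintegral_eq_sum_mass]
    refine Finset.sum_congr rfl fun x _ => ?_
    by_cases hx : mass Q x = 0
    · simp [hx]
    · have hsx : MeasurableSet (Prod.mk x ⁻¹' s) := measurable_prodMk_left hs
      rw [hW x hx, withDensity_apply _ hsx, ← lintegral_indicator hsx]
      rfl
  have hac : (Q : Measure X) ⊗ₘ W ≪ (Q : Measure X).prod μ := by
    rw [hJ]; exact withDensity_absolutelyContinuous _ _
  have hd : (∂((Q : Measure X) ⊗ₘ W)/∂((Q : Measure X).prod μ)) =ᵐ[(Q : Measure X).prod μ]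
      fun p => ENNReal.ofReal (h p.1 p.2) := by
    rw [hJ]
    exact Measure.rnDeriv_withDensity _ hm2.ennreal_ofReal
  rw [mutualInfo, klDiv_eq_lintegral_klFun_of_ac hac]
  have h1 : ∫⁻ p, ENNReal.ofReal (klFun ((∂((Q : Measure X) ⊗ₘ W)/∂((Q : Measure X).prod μ))
      p).toReal) ∂(Q : Measure X).prod μ
      = ∫⁻ p, ENNReal.ofReal (klFun (h p.1 p.2)) ∂(Q : Measure X).prod μ := by
    refine lintegral_congr_ae ?_
    filter_upwards [hd] with p hp
    rw [hp, ENNReal.toReal_ofReal (h0 _ _)]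
  rw [h1, lintegral_prod _ (by fun_prop), lintegral_eq_sum_mass]
  have h2 : ∀ x, mass Q x ≠ 0 → ∫⁻ y, ENNReal.ofReal (klFun (h x y)) ∂μ
      = ENNReal.ofReal (∫ y, h x y * Real.log (h x y) ∂μ) ∧
      0 ≤ ∫ y, h x y * Real.log (h x y) ∂μ := by
    intro x hx
    have hb : ∀ y, h x y ≤ 1 / mass Q x := fun y =>
      channel_density_le (mass_nonneg Q) (fun x => h0 x y) (hs y) hx
    obtain ⟨B, hB⟩ := exists_bound_of_continuous (h0 x) hb Real.continuous_mul_log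
    have hi1 : Integrable (fun y => h x y * Real.log (h x y)) μ :=
      integrable_of_bounded (by have := hm x; fun_prop) hB
    have hi2 : Integrable (fun y => h x y) μ :=
      integrable_of_bounded (hm x) fun y => by rw [abs_of_nonneg (h0 x y)]; exact hb y
    have he : ∫ y, klFun (h x y) ∂μ = ∫ y, h x y * Real.log (h x y) ∂μ := by
      have h3 : ∀ y, klFun (h x y) = h x y * Real.log (h x y) + (1 - h x y) := fun y => by
        rw [klFun]; ring
      simp_rw [h3]
      have hi3 : Integrable (fun y => 1 - h x y) μ := (integrable_const 1).sub hi2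
      rw [integral_add hi1 hi3,
        integral_sub (integrable_const 1) hi2, integral_density_eq_one (hm x) (h0 x) (hW x hx)]
      simp
    have hk0 : 0 ≤ᵐ[μ] fun y => klFun (h x y) := ae_of_all _ fun y => klFun_nonneg (h0 x y)
    refine ⟨?_, he ▸ integral_nonneg_of_ae hk0⟩
    rw [← he, ofReal_integral_eq_lintegral_ofReal _ hk0]
    refine (hi1.add ((integrable_const 1).sub hi2)).congr (ae_of_all _ fun y => ?_)
    simp [klFun]
    ring
  rw [ENNReal.ofReal_sum_of_nonneg]
  · refine Finset.sum_congr rfl fun x _ => ?_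
    by_cases hx : mass Q x = 0
    · simp [hx]
    · rw [(h2 x hx).1, ENNReal.ofReal_mul (mass_nonneg Q x)]
  · intro x _
    by_cases hx : mass Q x = 0
    · simp [hx]
    · exact mul_nonneg (mass_nonneg Q x) (h2 x hx).2

lemma integral_compProd_eq_sum (Q : ProbabilityMeasure X) (W : Kernel X Y) [IsMarkovKernel W]
    {d : X → Y → ℝ} {C : ℝ} (hC : ∀ x y, |d x y| ≤ C) (hd : ∀ x, Measurable (d x)) :
    ∫ p, d p.1 p.2 ∂((Q : Measure X) ⊗ₘ W) = ∑ x, mass Q x * ∫ y, d x y ∂W x := by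
  rw [Measure.integral_compProd, integral_eq_sum_mass]
  exact integrable_of_bounded (measurable_from_prod_countable_right hd) fun p => hC p.1 p.2

end MutualInformation

/-! ### Upper bounds for the rate-distortion function -/

section Certificates

variable {X Y : Type*} [MeasurableSpace X] [MeasurableSpace Y] [Fintype X]
  [MeasurableSingletonClass X]

lemma integral_mul_exp_neg_le {Z : Type*} [MeasurableSpace Z] {V ν : Measure Z}
    {g u : Z → ℝ} (hg : Measurable g) (hu : Measurable u) (hu0 : ∀ z, 0 ≤ u z)
    (hint : Integrable u ν)
    (hV : V ≤ ν.withDensity fun z => ENNReal.ofReal (Real.exp (g z))) :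
    ∫ z, u z * Real.exp (-g z) ∂V ≤ ∫ z, u z ∂ν := by
  have hnn : ∀ z, 0 ≤ u z * Real.exp (-g z) := fun z => mul_nonneg (hu0 z) (Real.exp_pos _).le
  rw [integral_eq_lintegral_of_nonneg_ae (ae_of_all _ hnn) (by fun_prop),
    integral_eq_lintegral_of_nonneg_ae (ae_of_all _ hu0) hu.aestronglyMeasurable]
  refine ENNReal.toReal_mono ?_ ?_
  · exact ((hasFiniteIntegral_iff_ofReal (ae_of_all _ hu0)).1 hint.2).ne
  · refine (lintegral_mono' hV le_rfl).trans ?_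
    rw [lintegral_withDensity_eq_lintegral_mul _ (by fun_prop) (by fun_prop)]
    refine lintegral_mono fun z => ?_
    rw [Pi.mul_apply, ← ENNReal.ofReal_mul (Real.exp_pos _).le]
    refine ENNReal.ofReal_le_ofReal (le_of_eq ?_)
    rw [mul_left_comm, ← Real.exp_add]
    simp

/-- Upper bounds on the rate-distortion function. The channel is presented through an auxiliary
output alphabet `Z` and a map `π : Z → Y`, and its information cost is bounded by the mean of any
`g` such that `V x ≤ exp (g x) · ν` for some common reference law `ν` on `Z`. The reference law need
not be the output law, so that this lemma comprises the variational formula for the mutual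
information and the data processing inequality; it holds because
`log t ≤ t - 1`. -/
lemma rateDistortion_le_of_density_le {Z : Type*} [MeasurableSpace Z] {d : X → Y → ℝ} {dmax D : ℝ}
    (hd : ∀ x y, 0 ≤ d x y ∧ d x y ≤ dmax) (hmeas : ∀ x, Measurable (d x))
    (Q : ProbabilityMeasure X) {π : Z → Y} (hπ : Measurable π) (V : X → Measure Z)
    [∀ x, IsProbabilityMeasure (V x)] (ν : Measure Z) [IsProbabilityMeasure ν] {g : X → Z → ℝ}
    (hg : ∀ x, Measurable (g x)) {C : ℝ} (hC : ∀ x z, |g x z| ≤ C)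
    (hV : ∀ x, mass Q x ≠ 0 →
      V x ≤ ν.withDensity fun z => ENNReal.ofReal (Real.exp (g x z)))
    (hdist : ∑ x, mass Q x * ∫ z, d x (π z) ∂V x ≤ D) :
    rateDistortion d D Q ≤ ENNReal.ofReal (∑ x, mass Q x * ∫ z, g x z ∂V x) := by
  let W : Kernel X Y := Kernel.ofFunOfCountable fun x => (V x).map π
  have hWx : ∀ x, W x = (V x).map π := fun x => rfl
  have hWp : ∀ x, IsProbabilityMeasure (W x) := fun x => by
    rw [hWx]; exact Measure.isProbabilityMeasure_map hπ.aemeasurable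
  have : IsMarkovKernel W := ⟨hWp⟩
  have hadm : W ∈ admissibleChannels d D Q := by
    refine ⟨this, ?_⟩
    rw [integral_compProd_eq_sum Q W (C := dmax)
      (fun x y => by rw [abs_of_nonneg (hd x y).1]; exact (hd x y).2) hmeas]
    refine le_of_eq_of_le (Finset.sum_congr rfl fun x _ => ?_) hdist
    rw [hWx, integral_map hπ.aemeasurable (hmeas x).aestronglyMeasurable]
  refine (iInf₂_le W hadm).trans ?_
  obtain ⟨h, hm, h0, hs, hW⟩ := exists_channel_density Q W
  rw [mutualInfo_eq Q W hm h0 hs hW]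
  -- With `h + η` in place of the density `h`, all logarithms are bounded, hence integrable.
  refine ENNReal.ofReal_le_ofReal (le_of_forall_pos_le_add fun η hη => ?_)
  set μ := W ∘ₘ (Q : Measure X)
  have hb : ∀ x, mass Q x ≠ 0 → ∀ y, h x y ≤ 1 / mass Q x := fun x hx y =>
    channel_density_le (mass_nonneg Q) (fun x => h0 x y) (hs y) hx
  have hpos : ∀ x y, 0 < h x y + η := fun x y => add_pos_of_nonneg_of_pos (h0 x y) hη
  have key : ∀ x, mass Q x ≠ 0 → ∫ y, h x y * Real.log (h x y) ∂μ
      ≤ ∫ z, g x z ∂V x + (∫ z, h x (π z) ∂ν + η - 1) := by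
    intro x hx
    have hmx := hm x
    have hgx := hg x
    obtain ⟨B, hB⟩ := exists_bound_of_continuous (h0 x) (hb x hx) Real.continuous_mul_log
    have hcont : Continuous fun t : ℝ => Real.log (|t| + η) :=
      (continuous_abs.add continuous_const).log fun t =>
      (add_pos_of_nonneg_of_pos (abs_nonneg t) hη).ne'
    obtain ⟨B', hB'⟩ := exists_bound_of_continuous (h0 x) (hb x hx) hcont
    have hB'' : ∀ y, |Real.log (h x y + η)| ≤ B' := fun y => by
      simpa [abs_of_nonneg (h0 x y)] using hB' y
    obtain ⟨B₂, hB₂⟩ := exists_bound_of_continuous (h0 x) (hb x hx)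
      (continuous_id.mul hcont)
    have hB₃ : ∀ y, |h x y * Real.log (h x y + η)| ≤ B₂ := fun y => by
      simpa [abs_of_nonneg (h0 x y)] using hB₂ y
    have e1 : ∫ y, h x y * Real.log (h x y) ∂μ ≤ ∫ y, h x y * Real.log (h x y + η) ∂μ := by
      refine integral_mono (integrable_of_bounded (by fun_prop) hB)
        (integrable_of_bounded (by fun_prop) hB₃) fun y => ?_
      rcases eq_or_lt_of_le (h0 x y) with h | h
      · simp [← h]
      · dsimp only
        gcongr
        linarith
    have e2 : ∫ y, h x y * Real.log (h x y + η) ∂μ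
        = ∫ z, Real.log (h x (π z) + η) ∂V x := by
      rw [← integral_withDensity_ofReal hmx (h0 x), ← hW x hx, hWx,
        integral_map hπ.aemeasurable
          (f := fun y => Real.log (h x y + η))
          (Measurable.aestronglyMeasurable (by fun_prop))]
    have i1 : Integrable (fun z => Real.log (h x (π z) + η)) (V x) :=
      integrable_of_bounded (by fun_prop) fun z => hB'' _
    have i2 : Integrable (g x) (V x) := integrable_of_bounded hgx (hC x)
    have i3 : Integrable (fun z => (h x (π z) + η) * Real.exp (-g x z)) (V x) := by
      refine integrable_of_bounded (C := (1 / mass Q x + η) * Real.exp C) (by fun_prop)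
        fun z => ?_
      rw [abs_of_nonneg (mul_nonneg (hpos _ _).le (Real.exp_pos _).le)]
      have := hb x hx (π z)
      have := (hpos x (π z)).le
      have := (neg_le_abs _).trans (hC x z)
      gcongr
      linarith
    have i4 : Integrable (fun z => h x (π z) + η) ν :=
      integrable_of_bounded (C := 1 / mass Q x + η) (by fun_prop) fun z => by
        rw [abs_of_nonneg (hpos _ _).le]
        have := hb x hx (π z)
        linarith
    have i5 : Integrable (fun z => h x (π z)) ν :=
      (i4.sub (integrable_const η)).congr (ae_of_all _ fun z => by simp)
    have e3 : ∫ z, Real.log (h x (π z) + η) ∂V x - ∫ z, g x z ∂V x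
        ≤ ∫ z, (h x (π z) + η) * Real.exp (-g x z) ∂V x - 1 := by
      have h1 : ∫ _ : Z, (1 : ℝ) ∂V x = 1 := by simp
      rw [← integral_sub i1 i2]
      conv_rhs => rw [← h1, ← integral_sub i3 (integrable_const _)]
      refine integral_mono (i1.sub i2) (i3.sub (integrable_const _)) fun z => ?_
      have h2 := Real.log_le_sub_one_of_pos (mul_pos (hpos x (π z)) (Real.exp_pos (-g x z)))
      rw [Real.log_mul (hpos _ _).ne' (Real.exp_pos _).ne', Real.log_exp] at h2
      dsimp only
      linarith
    have e4 := integral_mul_exp_neg_le (u := fun z => h x (π z) + η) hgx (by fun_prop)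
      (fun z => (hpos x (π z)).le) i4 (hV x hx)
    have e5 : ∫ z, (h x (π z) + η) ∂ν = ∫ z, h x (π z) ∂ν + η := by
      rw [integral_add i5 (integrable_const _)]
      simp
    linarith
  have hsum : ∑ x, mass Q x * ∫ z, h x (π z) ∂ν ≤ 1 := by
    have i6 : ∀ x, Integrable (fun z => mass Q x * h x (π z)) ν := fun x => by
      have := hm x
      refine integrable_of_bounded (C := 1) (by fun_prop) fun z => ?_
      rw [abs_of_nonneg (mul_nonneg (mass_nonneg Q x) (h0 _ _))]
      exact (Finset.single_le_sum (f := fun x => mass Q x * h x (π z))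
        (fun x _ => mul_nonneg (mass_nonneg Q x) (h0 _ _)) (Finset.mem_univ x)).trans (hs _)
    calc ∑ x, mass Q x * ∫ z, h x (π z) ∂ν = ∫ z, ∑ x, mass Q x * h x (π z) ∂ν := by
          rw [integral_finsetSum _ fun x _ => i6 x]
          simp_rw [integral_const_mul]
      _ ≤ ∫ _, (1 : ℝ) ∂ν := integral_mono (integrable_finsetSum _ fun x _ => i6 x)
          (integrable_const _) fun z => hs _
      _ = 1 := by simp
  calc ∑ x, mass Q x * ∫ y, h x y * Real.log (h x y) ∂μ
      ≤ ∑ x, mass Q x * (∫ z, g x z ∂V x + (∫ z, h x (π z) ∂ν + η - 1)) := by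
        refine Finset.sum_le_sum fun x _ => ?_
        by_cases hx : mass Q x = 0
        · simp [hx]
        · exact mul_le_mul_of_nonneg_left (key x hx) (mass_nonneg Q x)
    _ = ∑ x, mass Q x * ∫ z, g x z ∂V x + (∑ x, mass Q x * ∫ z, h x (π z) ∂ν)
        + (∑ x, mass Q x) * (η - 1) := by
        rw [Finset.sum_mul, ← Finset.sum_add_distrib, ← Finset.sum_add_distrib]
        exact Finset.sum_congr rfl fun x _ => by ring
    _ ≤ ∑ x, mass Q x * ∫ z, g x z ∂V x + η := by
        rw [sum_mass]
        linarith

/-- Conversely, every channel has a bounded `g` of this kind, with the output law as reference,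
whose mean is as close to the mutual information as desired. The logarithm of the density itself
is unbounded below; adding a small constant to the density repairs this. -/
lemma exists_bounded_density (Q : ProbabilityMeasure X) (W : Kernel X Y) [IsMarkovKernel W]
    {η : ℝ} (hη : 0 < η) :
    ∃ (g : X → Y → ℝ) (C : ℝ), (∀ x, Measurable (g x)) ∧ (∀ x y, |g x y| ≤ C) ∧
      (∀ x, mass Q x ≠ 0 → W x ≤ (W ∘ₘ (Q : Measure X)).withDensity
        fun y => ENNReal.ofReal (Real.exp (g x y))) ∧
      ∑ x, mass Q x * ∫ y, g x y ∂W x ≤ (mutualInfo Q W).toReal + η := by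
  classical
  obtain ⟨h, hm, h0, hs, hW⟩ := exists_channel_density Q W
  rw [mutualInfo_eq Q W hm h0 hs hW]
  set μ := W ∘ₘ (Q : Measure X)
  have hb : ∀ x, mass Q x ≠ 0 → ∀ y, h x y ≤ 1 / mass Q x := fun x hx y =>
    channel_density_le (mass_nonneg Q) (fun x => h0 x y) (hs y) hx
  have hpos : ∀ x y, 0 < h x y + η := fun x y => add_pos_of_nonneg_of_pos (h0 x y) hη
  have hcont : Continuous fun t : ℝ => Real.log (|t| + η) :=
    (continuous_abs.add continuous_const).log fun t =>
      (add_pos_of_nonneg_of_pos (abs_nonneg t) hη).ne'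
  have hbd : ∀ x, ∃ B, ∀ y, |if mass Q x = 0 then 0 else Real.log (h x y + η)| ≤ B := by
    intro x
    by_cases hx : mass Q x = 0
    · exact ⟨0, by simp [hx]⟩
    · obtain ⟨B', hB'⟩ := exists_bound_of_continuous (h0 x) (hb x hx) hcont
      exact ⟨B', fun y => by simpa [hx, abs_of_nonneg (h0 x y)] using hB' y⟩
  choose B hB using hbd
  refine ⟨fun x y => if mass Q x = 0 then 0 else Real.log (h x y + η), ∑ x, |B x|, fun x => ?_,
    fun x y => ?_, fun x hx => ?_, ?_⟩
  · have := hm x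
    by_cases hx : mass Q x = 0 <;> simp only [hx, if_true, if_false] <;> fun_prop
  · exact ((hB x y).trans (le_abs_self _)).trans
      (Finset.single_le_sum (f := fun x => |B x|) (fun _ _ => abs_nonneg _) (Finset.mem_univ x))
  · conv_lhs => rw [hW x hx]
    refine withDensity_mono (ae_of_all _ fun y => ENNReal.ofReal_le_ofReal ?_)
    simp only [hx, if_false, Real.exp_log (hpos x y)]
    linarith
  · have key : ∀ x, mass Q x ≠ 0 → ∫ y, Real.log (h x y + η) ∂W x
        ≤ ∫ y, h x y * Real.log (h x y) ∂μ + η := by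
      intro x hx
      have hmx := hm x
      obtain ⟨B₁, hB₁⟩ := exists_bound_of_continuous (h0 x) (hb x hx) Real.continuous_mul_log
      obtain ⟨B₂, hB₂⟩ := exists_bound_of_continuous (h0 x) (hb x hx) (continuous_id.mul hcont)
      have hB₃ : ∀ y, |h x y * Real.log (h x y + η)| ≤ B₂ := fun y => by
        simpa [abs_of_nonneg (h0 x y)] using hB₂ y
      have i1 : Integrable (fun y => h x y * Real.log (h x y)) μ :=
        integrable_of_bounded (by fun_prop) hB₁
      rw [hW x hx, integral_withDensity_ofReal hmx (h0 x)]
      calc ∫ y, h x y * Real.log (h x y + η) ∂μ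
          ≤ ∫ y, (h x y * Real.log (h x y) + η) ∂μ := by
            refine integral_mono (integrable_of_bounded (by fun_prop) hB₃)
              (i1.add (integrable_const _)) fun y => ?_
            rcases eq_or_lt_of_le (h0 x y) with h' | h'
            · simp [← h', hη.le]
            · have h2 := Real.log_le_sub_one_of_pos (div_pos (hpos x y) h')
              rw [Real.log_div (hpos x y).ne' h'.ne'] at h2
              have h3 := mul_le_mul_of_nonneg_left h2 h'.le
              have h4 : h x y * ((h x y + η) / h x y - 1) = η := by field_simp; ring
              dsimp only
              linarith
        _ = _ := by
            rw [integral_add i1 (integrable_const _)]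
            simp
    calc ∑ x, mass Q x * ∫ y, (if mass Q x = 0 then 0 else Real.log (h x y + η)) ∂W x
        ≤ ∑ x, mass Q x * (∫ y, h x y * Real.log (h x y) ∂μ + η) := by
          refine Finset.sum_le_sum fun x _ => ?_
          by_cases hx : mass Q x = 0
          · simp [hx]
          · simp only [hx, if_false]
            exact mul_le_mul_of_nonneg_left (key x hx) (mass_nonneg Q x)
      _ = ∑ x, mass Q x * ∫ y, h x y * Real.log (h x y) ∂μ + η := by
          simp_rw [mul_add, Finset.sum_add_distrib, ← Finset.sum_mul, sum_mass, one_mul]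
      _ ≤ _ := by
          gcongr
          rw [ENNReal.toReal_ofReal']
          exact le_max_left _ _

end Certificates

/-! ### Test channels -/

section TestChannels

variable {X Y : Type*} [MeasurableSpace X] [MeasurableSpace Y] [Fintype X]
  [MeasurableSingletonClass X]

/-- A channel from `X` to `Z` together with a reference law on `Z` and a bounded function `cost`
for which `law x ≤ exp (cost x) · ref`. The mean of `cost` bounds the information which the channel
conveys, whatever the input law. -/
structure TestChannel (X Z : Type*) [MeasurableSpace Z] where
  /-- the law of the output for a given input -/
  law : X → Measure Z
  /-- the law from which guesses will be drawn -/
  ref : Measure Z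
  /-- a bound for the logarithmic density of `law x` with respect to `ref` -/
  cost : X → Z → ℝ
  /-- a bound for `cost` -/
  bound : ℝ
  isProbabilityMeasure_law : ∀ x, IsProbabilityMeasure (law x)
  isProbabilityMeasure_ref : IsProbabilityMeasure ref
  measurable_cost : ∀ x, Measurable (cost x)
  abs_cost_le : ∀ x z, |cost x z| ≤ bound
  law_le : ∀ x, law x ≤ ref.withDensity fun z => ENNReal.ofReal (Real.exp (cost x z))

attribute [instance] TestChannel.isProbabilityMeasure_law TestChannel.isProbabilityMeasure_ref

/-- The measure on a finite type with the given point weights. -/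
def ofWeights {Z : Type*} [MeasurableSpace Z] [Fintype Z] (w : Z → ℝ) : Measure Z :=
  ∑ z, ENNReal.ofReal (w z) • Measure.dirac z

lemma isProbabilityMeasure_ofWeights {Z : Type*} [MeasurableSpace Z] [Fintype Z] {w : Z → ℝ}
    (h0 : ∀ z, 0 ≤ w z) (h1 : ∑ z, w z = 1) : IsProbabilityMeasure (ofWeights w) := by
  constructor
  simp only [ofWeights, Measure.coe_finsetSum, Finset.sum_apply, Measure.smul_apply,
    measure_univ, smul_eq_mul, mul_one]
  rw [← ENNReal.ofReal_sum_of_nonneg fun z _ => h0 z, h1, ENNReal.ofReal_one]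

lemma smul_dirac_le_ofWeights {Z : Type*} [MeasurableSpace Z] [Fintype Z] (w : Z → ℝ) (z : Z) :
    ENNReal.ofReal (w z) • Measure.dirac z ≤ ofWeights w :=
  Finset.single_le_sum (f := fun z => ENNReal.ofReal (w z) • Measure.dirac z)
    (fun _ _ => Measure.zero_le _) (Finset.mem_univ z)

lemma integral_ofWeights {Z : Type*} [MeasurableSpace Z] [MeasurableSingletonClass Z] [Fintype Z]
    {w : Z → ℝ} (h0 : ∀ z, 0 ≤ w z) (f : Z → ℝ) : ∫ z, f z ∂ofWeights w = ∑ z, w z * f z := by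
  rw [ofWeights, integral_finsetSum_measure fun z _ =>
    (integrable_dirac (by simp)).smul_measure ENNReal.ofReal_ne_top]
  refine Finset.sum_congr rfl fun z _ => ?_
  rw [integral_smul_measure, integral_dirac, ENNReal.toReal_ofReal (h0 z), smul_eq_mul]

lemma ofWeights_singleton {Z : Type*} [MeasurableSpace Z] [MeasurableSingletonClass Z] [Fintype Z]
    (w : Z → ℝ) (z : Z) : ofWeights w {z} = ENNReal.ofReal (w z) := by
  classical
  simp [ofWeights, Measure.coe_finsetSum, Set.indicator]

/-- The uniform law on the input alphabet. -/
def uniformLaw (X : Type*) [MeasurableSpace X] [Fintype X] : Measure X :=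
  ofWeights fun _ : X => 1 / (Fintype.card X : ℝ)

lemma smul_dirac_le_uniformLaw {X : Type*} [MeasurableSpace X] [Fintype X] (x : X) :
    ENNReal.ofReal (1 / (Fintype.card X : ℝ)) • Measure.dirac x ≤ uniformLaw X :=
  smul_dirac_le_ofWeights (fun _ : X => 1 / (Fintype.card X : ℝ)) x

lemma isProbabilityMeasure_uniformLaw {X : Type*} [MeasurableSpace X] [Fintype X] [Nonempty X] :
    IsProbabilityMeasure (uniformLaw X) := by
  have hc : (0 : ℝ) < Fintype.card X := by exact_mod_cast Fintype.card_pos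
  refine isProbabilityMeasure_ofWeights (fun _ => by positivity) ?_
  rw [Finset.sum_const, Finset.card_univ, nsmul_eq_mul, mul_one_div_cancel hc.ne']

lemma withDensity_mono_left {Z : Type*} [MeasurableSpace Z] {μ ν : Measure Z} (h : μ ≤ ν)
    (f : Z → ℝ≥0∞) : μ.withDensity f ≤ ν.withDensity f := by
  refine Measure.le_intro fun s hs _ => ?_
  rw [withDensity_apply _ hs, withDensity_apply _ hs]
  exact lintegral_mono' (Measure.restrict_mono le_rfl h) le_rfl

lemma map_withDensity_comp {Z Z' : Type*} [MeasurableSpace Z] [MeasurableSpace Z'] {μ : Measure Z}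
    {φ : Z → Z'} (hφ : Measurable φ) {G : Z' → ℝ≥0∞} (hG : Measurable G) :
    (μ.map φ).withDensity G = (μ.withDensity fun z => G (φ z)).map φ := by
  ext s hs
  rw [withDensity_apply _ hs, setLIntegral_map hs hG hφ, Measure.map_apply hφ hs,
    withDensity_apply _ (hφ hs)]

lemma nonempty_of_probabilityMeasure (Q : ProbabilityMeasure X) : Nonempty X := by
  by_contra h
  rw [not_nonempty_iff] at h
  have := sum_mass Q
  simp at this

lemma rateDistortion_ne_top {d : X → Y → ℝ} {dmax D : ℝ}
    (hd : ∀ x y, 0 ≤ d x y ∧ d x y ≤ dmax) (hmeas : ∀ x, Measurable (d x)) (hD : 0 ≤ D)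
    {zero : X → Y} (hzero : ∀ x, d x (zero x) = 0) (Q : ProbabilityMeasure X) :
    rateDistortion d D Q ≠ ⊤ := by
  have : Nonempty X := nonempty_of_probabilityMeasure Q
  have hc : (0 : ℝ) < Fintype.card X := by exact_mod_cast Fintype.card_pos
  have := isProbabilityMeasure_uniformLaw (X := X)
  refine ne_top_of_le_ne_top ENNReal.ofReal_ne_top (rateDistortion_le_of_density_le hd hmeas Q
    (Z := X) (π := zero) Measurable.of_discrete (fun x => Measure.dirac x) (uniformLaw X)
    (g := fun _ _ => Real.log (Fintype.card X)) (fun _ => measurable_const)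
    (C := |Real.log (Fintype.card X)|) (fun _ _ => le_rfl) (fun x _ => ?_) ?_)
  · refine le_trans ?_ (withDensity_mono_left (smul_dirac_le_uniformLaw x) _)
    rw [Real.exp_log hc, withDensity_const, smul_smul, ← ENNReal.ofReal_mul hc.le,
      mul_one_div_cancel hc.ne', ENNReal.ofReal_one, one_smul]
  · simp [hzero, hD]

/-- The mixture, on the disjoint union, of a law on `Y` and a law on `X` in the proportions
`1 - lam` and `lam`. -/
def flaggedMixture (lam : ℝ) (ρ : Measure Y) (σ : Measure X) : Measure (Y ⊕ X) :=
  ENNReal.ofReal (1 - lam) • ρ.map Sum.inl + ENNReal.ofReal lam • σ.map Sum.inr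

lemma isProbabilityMeasure_flaggedMixture {X Y : Type*} [MeasurableSpace X] [MeasurableSpace Y]
    {lam : ℝ} (h0 : 0 ≤ lam) (h1 : lam ≤ 1) (ρ : Measure Y) (σ : Measure X)
    [IsProbabilityMeasure ρ] [IsProbabilityMeasure σ] :
    IsProbabilityMeasure (flaggedMixture lam ρ σ) := by
  constructor
  rw [flaggedMixture, Measure.add_apply, Measure.smul_apply, Measure.smul_apply,
    Measure.map_apply measurable_inl MeasurableSet.univ,
    Measure.map_apply measurable_inr MeasurableSet.univ]
  simp only [Set.preimage_univ, measure_univ, smul_eq_mul, mul_one]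
  rw [← ENNReal.ofReal_add (by linarith) h0]
  simp

lemma integral_flaggedMixture {X Y : Type*} [MeasurableSpace X] [MeasurableSpace Y]
    {lam : ℝ} (h0 : 0 ≤ lam) (h1 : lam ≤ 1) (ρ : Measure Y)
    [IsProbabilityMeasure ρ] (x : X) {f : Y ⊕ X → ℝ} (hf : Measurable f) {C : ℝ}
    (hC : ∀ z, |f z| ≤ C) :
    ∫ z, f z ∂flaggedMixture lam ρ (Measure.dirac x)
      = (1 - lam) * ∫ y, f (Sum.inl y) ∂ρ + lam * f (Sum.inr x) := by
  rw [flaggedMixture, integral_add_measure, integral_smul_measure, integral_smul_measure,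
    Measure.map_dirac' measurable_inr, integral_dirac' _ _ hf.stronglyMeasurable,
    integral_map measurable_inl.aemeasurable hf.aestronglyMeasurable,
    ENNReal.toReal_ofReal (by linarith), ENNReal.toReal_ofReal h0, smul_eq_mul, smul_eq_mul]
  · have : IsFiniteMeasure (ρ.map (Sum.inl : Y → Y ⊕ X)) := inferInstance
    exact (integrable_of_bounded hf hC).smul_measure ENNReal.ofReal_ne_top
  · exact (integrable_of_bounded hf hC).smul_measure ENNReal.ofReal_ne_top

/-- Near-optimal test channels. The channel is a nearly optimal admissible channel, mixed with a
small proportion of the error-free deterministic channel `zero`, on a disjoint copy `X` of the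
outputs. The admixture makes the channel meaningful for inputs outside the support of `Q` and makes
the distortion strictly smaller than `D`, unless it vanishes identically. -/
lemma exists_testChannel {d : X → Y → ℝ} {dmax D : ℝ}
    (hd : ∀ x y, 0 ≤ d x y ∧ d x y ≤ dmax) (hmeas : ∀ x, Measurable (d x)) (hD : 0 ≤ D)
    {zero : X → Y} (hzero : ∀ x, d x (zero x) = 0) (Q : ProbabilityMeasure X)
    {ε : ℝ} (hε : 0 < ε) :
    ∃ T : TestChannel X (Y ⊕ X),
      ∑ x, mass Q x * ∫ z, T.cost x z ∂T.law x ≤ (rateDistortion d D Q).toReal + ε ∧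
      (∑ x, mass Q x * ∫ z, d x (Sum.elim id zero z) ∂T.law x < D ∨
        ∀ x, ∀ᵐ z ∂T.law x, d x (Sum.elim id zero z) = 0) := by
  classical
  have : Nonempty X := nonempty_of_probabilityMeasure Q
  have hc : (0 : ℝ) < Fintype.card X := by exact_mod_cast Fintype.card_pos
  have hunif := isProbabilityMeasure_uniformLaw (X := X)
  have hRtop := rateDistortion_ne_top hd hmeas hD hzero Q
  have hlt : rateDistortion d D Q < rateDistortion d D Q + ENNReal.ofReal (ε / 3) :=
    ENNReal.lt_add_right hRtop (by simpa using by positivity)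
  conv_lhs at hlt => rw [rateDistortion]
  obtain ⟨W, hW⟩ := iInf_lt_iff.1 hlt
  obtain ⟨⟨hWm, hWd⟩, hWI⟩ := iInf_lt_iff.1 hW
  have hπ : Measurable (Sum.elim id zero : Y ⊕ X → Y) :=
    measurable_id.sumElim Measurable.of_discrete
  have hdb : ∀ x y, |d x y| ≤ dmax := fun x y => by
    rw [abs_of_nonneg (hd x y).1]; exact (hd x y).2
  rw [integral_compProd_eq_sum Q W hdb hmeas] at hWd
  obtain ⟨g, C, hgm, hgC, hgW, hgI⟩ := exists_bounded_density Q W (η := ε / 3) (by positivity)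
  set μ := W ∘ₘ (Q : Measure X)
  set S := ∑ x, mass Q x * ∫ y, g x y ∂W x with hS
  have hSR : S ≤ (rateDistortion d D Q).toReal + 2 * (ε / 3) := by
    have h1 : (mutualInfo Q W).toReal ≤ (rateDistortion d D Q).toReal + ε / 3 := by
      refine (ENNReal.toReal_mono (by finiteness) hWI.le).trans_eq ?_
      rw [ENNReal.toReal_add hRtop (by finiteness), ENNReal.toReal_ofReal (by positivity)]
    linarith
  set L := Real.log (Fintype.card X) with hL
  obtain ⟨lam, hl0, hl1, hlL⟩ : ∃ lam : ℝ, 0 < lam ∧ lam < 1 ∧ lam * |L - S| ≤ ε / 3 := by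
    have h1 : 0 < 1 + |L - S| := by positivity
    refine ⟨min (1 / 2) (ε / 3 / (1 + |L - S|)), by positivity,
      (min_le_left _ _).trans_lt (by norm_num), ?_⟩
    refine (mul_le_mul_of_nonneg_right (min_le_right _ _) (abs_nonneg _)).trans ?_
    rw [div_mul_eq_mul_div, div_le_iff₀ h1]
    have := abs_nonneg (L - S)
    nlinarith
  set cost : X → Y ⊕ X → ℝ := fun x =>
    if mass Q x = 0 then fun _ => Real.log (Fintype.card X / lam)
    else Sum.elim (g x) fun _ => L with hcost
  set law : X → Measure (Y ⊕ X) := fun x =>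
    if mass Q x = 0 then Measure.dirac (Sum.inr x)
    else flaggedMixture lam (W x) (Measure.dirac x) with hlaw
  have hcm : ∀ x, Measurable (cost x) := fun x => by
    by_cases hx : mass Q x = 0
    · simp only [hcost, hx, if_true]; fun_prop
    · simp only [hcost, hx, if_false]
      exact (hgm x).sumElim measurable_const
  have hcb : ∀ x z, |cost x z| ≤ |C| + |L| + |Real.log (Fintype.card X / lam)| := fun x z => by
    have h1 := abs_nonneg C
    have h2 := abs_nonneg L
    have h3 := abs_nonneg (Real.log (Fintype.card X / lam))
    by_cases hx : mass Q x = 0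
    · simp only [hcost, hx, if_true]; linarith
    · rcases z with y | x'
      · simp only [hcost, hx, if_false, Sum.elim_inl]
        have := (hgC x y).trans (le_abs_self C)
        linarith
      · simp only [hcost, hx, if_false, Sum.elim_inr]
        linarith
  have hprob : ∀ x, IsProbabilityMeasure (law x) := fun x => by
    by_cases hx : mass Q x = 0
    · simp only [hlaw, hx, if_true]; infer_instance
    · simp only [hlaw, hx, if_false]
      exact isProbabilityMeasure_flaggedMixture hl0.le hl1.le _ _
  have hle : ∀ x, law x ≤ (flaggedMixture lam μ (uniformLaw X)).withDensity
      fun z => ENNReal.ofReal (Real.exp (cost x z)) := by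
    intro x
    have hGm : Measurable fun z => ENNReal.ofReal (Real.exp (cost x z)) := by
      have := hcm x
      fun_prop
    have hdir : ENNReal.ofReal (lam / Fintype.card X * Real.exp (cost x (Sum.inr x))) •
        Measure.dirac (Sum.inr x : Y ⊕ X) ≤ (ENNReal.ofReal lam •
          (uniformLaw X).map (Sum.inr : X → Y ⊕ X)).withDensity
            fun z => ENNReal.ofReal (Real.exp (cost x z)) := by
      have h1 := Measure.map_mono (smul_dirac_le_uniformLaw x)
        (measurable_inr : Measurable (Sum.inr : X → Y ⊕ X))
      rw [Measure.map_smul, Measure.map_dirac' measurable_inr] at h1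
      have h2 := withDensity_mono_left (μ := ENNReal.ofReal lam •
          (ENNReal.ofReal (1 / (Fintype.card X : ℝ)) • Measure.dirac (Sum.inr x : Y ⊕ X)))
        (ν := ENNReal.ofReal lam • (uniformLaw X).map (Sum.inr : X → Y ⊕ X))
        (by gcongr) (fun z => ENNReal.ofReal (Real.exp (cost x z)))
      refine le_trans (le_of_eq ?_) h2
      rw [withDensity_smul_measure, withDensity_smul_measure, dirac_withDensity' hGm,
        smul_smul, smul_smul, ← ENNReal.ofReal_mul (by positivity),
        ← ENNReal.ofReal_mul (by positivity)]
      congr 2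
      ring
    rw [flaggedMixture, withDensity_add_measure]
    by_cases hx : mass Q x = 0
    · refine le_trans ?_ (Measure.le_add_left hdir)
      simp only [hlaw, hcost, hx, if_true]
      rw [Real.exp_log (by positivity), div_mul_div_cancel₀ hc.ne', div_self hl0.ne',
        ENNReal.ofReal_one, one_smul]
    · simp only [hlaw, hx, if_false, flaggedMixture]
      refine add_le_add ?_ ?_
      · rw [withDensity_smul_measure, map_withDensity_comp measurable_inl hGm]
        gcongr
        · exact measurable_inl
        simpa only [hcost, hx, if_false, Sum.elim_inl] using hgW x hx
      · rw [Measure.map_dirac' measurable_inr]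
        refine le_trans (le_of_eq ?_) hdir
        simp only [hcost, hx, if_false, Sum.elim_inr, hL]
        rw [Real.exp_log hc, div_mul_cancel₀ _ hc.ne']
  refine ⟨⟨law, flaggedMixture lam μ (uniformLaw X), cost, _, hprob,
    isProbabilityMeasure_flaggedMixture hl0.le hl1.le _ _, hcm, hcb, hle⟩, ?_, ?_⟩
  · have h1 : ∑ x, mass Q x * ∫ z, cost x z ∂law x = (1 - lam) * S + lam * L := by
      have h2 : ∀ x, mass Q x * ∫ z, cost x z ∂law x
          = (1 - lam) * (mass Q x * ∫ y, g x y ∂W x) + mass Q x * (lam * L) := by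
        intro x
        by_cases hx : mass Q x = 0
        · simp [hx]
        · have h3 : law x = flaggedMixture lam (W x) (Measure.dirac x) := by simp [hlaw, hx]
          rw [h3, integral_flaggedMixture hl0.le hl1.le _ _ (hcm x) (hcb x)]
          simp only [hcost, hx, if_false, Sum.elim_inl, Sum.elim_inr]
          ring
      rw [Finset.sum_congr rfl fun x _ => h2 x, Finset.sum_add_distrib, ← Finset.mul_sum,
        ← Finset.sum_mul, sum_mass, one_mul]
    show ∑ x, mass Q x * ∫ z, cost x z ∂law x ≤ _
    rw [h1]
    have h2 : lam * (L - S) ≤ lam * |L - S| := by gcongr; exact le_abs_self _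
    linarith
  · have hdm : ∀ x, Measurable fun z : Y ⊕ X => d x (Sum.elim id zero z) := fun x =>
      (hmeas x).comp hπ
    rcases eq_or_lt_of_le hD with h0 | h0
    · right
      intro x
      show ∀ᵐ z ∂law x, d x (Sum.elim id zero z) = 0
      have hset : MeasurableSet {z : Y ⊕ X | d x (Sum.elim id zero z) = 0} :=
        hdm x (measurableSet_singleton 0)
      by_cases hx : mass Q x = 0
      · simp only [hlaw, hx, if_true]
        rw [ae_dirac_iff hset]
        exact hzero x
      · have h3 : law x = flaggedMixture lam (W x) (Measure.dirac x) := by simp [hlaw, hx]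
        have h4 : ∀ x, 0 ≤ mass Q x * ∫ y, d x y ∂W x := fun x =>
          mul_nonneg (mass_nonneg Q x) (integral_nonneg fun y => (hd x y).1)
        have h5 : mass Q x * ∫ y, d x y ∂W x = 0 :=
          le_antisymm ((Finset.single_le_sum (f := fun x => mass Q x * ∫ y, d x y ∂W x)
            (fun x _ => h4 x) (Finset.mem_univ x)).trans (h0 ▸ hWd)) (h4 x)
        have h6 : ∀ᵐ y ∂W x, d x y = 0 :=
          (integral_eq_zero_iff_of_nonneg (fun y => (hd x y).1)
            (integrable_of_bounded (hmeas x) (hdb x))).1 ((mul_eq_zero.1 h5).resolve_left hx)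
        rw [h3, flaggedMixture, ae_add_measure_iff]
        constructor
        · refine Measure.ae_smul_measure ?_ _
          rw [ae_map_iff measurable_inl.aemeasurable hset]
          exact h6
        · refine Measure.ae_smul_measure ?_ _
          rw [Measure.map_dirac' measurable_inr, ae_dirac_iff hset]
          exact hzero x
    · left
      show ∑ x, mass Q x * ∫ z, d x (Sum.elim id zero z) ∂law x < D
      have h2 : ∀ x, mass Q x * ∫ z, d x (Sum.elim id zero z) ∂law x
          = (1 - lam) * (mass Q x * ∫ y, d x y ∂W x) := by
        intro x
        by_cases hx : mass Q x = 0
        · simp [hx]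
        · have h3 : law x = flaggedMixture lam (W x) (Measure.dirac x) := by simp [hlaw, hx]
          rw [h3, integral_flaggedMixture hl0.le hl1.le _ _ (hdm x) (fun z => hdb x _)]
          simp only [Sum.elim_inl, Sum.elim_inr, id, hzero]
          ring
      rw [Finset.sum_congr rfl fun x _ => h2 x, ← Finset.mul_sum]
      nlinarith

/-- A test channel bounds the rate-distortion function at every input law at which it is
admissible. -/
lemma TestChannel.rateDistortion_le {Z : Type*} [MeasurableSpace Z] (T : TestChannel X Z)
    {d : X → Y → ℝ} {dmax D : ℝ} (hd : ∀ x y, 0 ≤ d x y ∧ d x y ≤ dmax)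
    (hmeas : ∀ x, Measurable (d x)) (Q : ProbabilityMeasure X) {π : Z → Y} (hπ : Measurable π)
    (hdist : ∑ x, mass Q x * ∫ z, d x (π z) ∂T.law x ≤ D) :
    rateDistortion d D Q ≤ ENNReal.ofReal (∑ x, mass Q x * ∫ z, T.cost x z ∂T.law x) :=
  rateDistortion_le_of_density_le hd hmeas Q hπ T.law T.ref T.measurable_cost T.abs_cost_le
    (fun x _ => T.law_le x) hdist

end TestChannels

/-! ### The single-letter bound -/

section SingleLetter

variable {X : Type*}

lemma prod_mass_update_mul (q : X → ℝ) {n : ℕ} (k : Fin n) (x : Fin n → X) (a : X) :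
    (∏ i, q (Function.update x k a i)) * q (x k) = (∏ i, q (x i)) * q a := by
  classical
  have h1 : ∀ i, q (Function.update x k a i) = Function.update (fun i => q (x i)) k (q a) i := by
    intro i
    by_cases h : i = k
    · subst h; simp
    · simp [h]
  simp_rw [h1]
  rw [Finset.prod_update_of_mem (Finset.mem_univ k),
    Finset.prod_eq_mul_prod_sdiff_singleton_of_mem (Finset.mem_univ k) (fun i => q (x i))]
  ring

variable [Fintype X]

/-- The mean of `F` under the `n`-fold product of the weights `q`. -/
def prodMean (q : X → ℝ) {n : ℕ} (F : (Fin n → X) → ℝ) : ℝ :=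
  ∑ x : Fin n → X, (∏ i, q (x i)) * F x

/-- Averaging of `F` over one coordinate. -/
def coordMean (q : X → ℝ) {n : ℕ} (k : Fin n) (F : (Fin n → X) → ℝ) (x : Fin n → X) : ℝ :=
  ∑ a, q a * F (Function.update x k a)

lemma prodMean_coordMean {q : X → ℝ} (hq : ∑ a, q a = 1) {n : ℕ} (k : Fin n)
    (F : (Fin n → X) → ℝ) : prodMean q (coordMean q k F) = prodMean q F := by
  classical
  have hinv : Function.Involutive fun p : (Fin n → X) × X => (Function.update p.1 k p.2, p.1 k) :=
    fun p => by simp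
  calc prodMean q (coordMean q k F)
      = ∑ p : (Fin n → X) × X, (∏ i, q (p.1 i)) * q p.2 * F (Function.update p.1 k p.2) := by
        simp_rw [prodMean, coordMean, Finset.mul_sum, Fintype.sum_prod_type, mul_assoc]
    _ = ∑ p : (Fin n → X) × X, (∏ i, q (p.1 i)) * q p.2 * F p.1 := by
        rw [← Equiv.sum_comp hinv.toPerm]
        refine Finset.sum_congr rfl fun p _ => ?_
        simp only [Function.Involutive.coe_toPerm, Function.update_idem, Function.update_eq_self]
        rw [prod_mass_update_mul]
    _ = prodMean q F := by
        simp_rw [Fintype.sum_prod_type, prodMean]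
        refine Finset.sum_congr rfl fun x _ => ?_
        rw [← Finset.sum_mul, ← Finset.mul_sum, hq, mul_one]

lemma prodMean_add (q : X → ℝ) {n : ℕ} (F G : (Fin n → X) → ℝ) :
    prodMean q (fun x => F x + G x) = prodMean q F + prodMean q G := by
  simp [prodMean, mul_add, Finset.sum_add_distrib]

lemma prodMean_sub (q : X → ℝ) {n : ℕ} (F G : (Fin n → X) → ℝ) :
    prodMean q (fun x => F x - G x) = prodMean q F - prodMean q G := by
  simp [prodMean, mul_sub, Finset.sum_sub_distrib]

lemma prodMean_sum (q : X → ℝ) {n : ℕ} {ι : Type*} (s : Finset ι) (F : ι → (Fin n → X) → ℝ) :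
    prodMean q (fun x => ∑ i ∈ s, F i x) = ∑ i ∈ s, prodMean q (F i) := by
  simp_rw [prodMean, Finset.mul_sum]
  exact Finset.sum_comm

lemma prodMean_mul_left (q : X → ℝ) {n : ℕ} (c : ℝ) (F : (Fin n → X) → ℝ) :
    prodMean q (fun x => c * F x) = c * prodMean q F := by
  simp_rw [prodMean, Finset.mul_sum, mul_left_comm]

lemma prodMean_one {q : X → ℝ} (hq : ∑ a, q a = 1) (n : ℕ) :
    prodMean q (fun _ : Fin n → X => 1) = 1 := by
  classical
  simp_rw [prodMean, mul_one]
  rw [← Fintype.prod_sum (fun (_ : Fin n) a => q a)]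
  simp [hq]

lemma prodMean_mono {q : X → ℝ} (hq : ∀ a, 0 ≤ q a) {n : ℕ} {F G : (Fin n → X) → ℝ}
    (h : ∀ x, (∏ i, q (x i)) ≠ 0 → F x ≤ G x) : prodMean q F ≤ prodMean q G := by
  refine Finset.sum_le_sum fun x _ => ?_
  by_cases hx : ∏ i, q (x i) = 0
  · simp [hx]
  · exact mul_le_mul_of_nonneg_left (h x hx) (Finset.prod_nonneg fun i _ => hq _)

variable {J : Type*} [DecidableEq J]

/-- The conditional probability that `φ(Xⁿ) = j`, given the coordinates of `Xⁿ` from the `k`-th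
on, for independent letters with law `q`. -/
def condProb (q : X → ℝ) {n : ℕ} (φ : (Fin n → X) → J) (j : J) : ℕ → (Fin n → X) → ℝ
  | 0 => fun x => if φ x = j then 1 else 0
  | k + 1 => if h : k < n then coordMean q ⟨k, h⟩ (condProb q φ j k) else condProb q φ j k

lemma condProb_succ (q : X → ℝ) {n : ℕ} (φ : (Fin n → X) → J) (j : J) (k : Fin n) :
    condProb q φ j (k + 1) = coordMean q k (condProb q φ j k) := by
  simp [condProb]

lemma condProb_nonneg {q : X → ℝ} (hq : ∀ a, 0 ≤ q a) {n : ℕ} (φ : (Fin n → X) → J) (j : J)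
    (k : ℕ) (x : Fin n → X) : 0 ≤ condProb q φ j k x := by
  induction k generalizing x with
  | zero => simp only [condProb]; split_ifs <;> norm_num
  | succ k ih =>
    rw [condProb]
    split_ifs
    · exact Finset.sum_nonneg fun a _ => mul_nonneg (hq a) (ih _)
    · exact ih x

lemma sum_condProb {q : X → ℝ} (hq : ∑ a, q a = 1) [Fintype J] {n : ℕ} (φ : (Fin n → X) → J)
    (k : ℕ) (x : Fin n → X) : ∑ j, condProb q φ j k x = 1 := by
  induction k generalizing x with
  | zero => simp [condProb]
  | succ k ih =>
    by_cases h : k < n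
    · simp only [condProb, h, dif_pos, coordMean]
      rw [Finset.sum_comm]
      simp_rw [← Finset.mul_sum, ih, mul_one, hq]
    · simpa only [condProb, h, dif_neg, not_false_eq_true] using ih x

/-- Averaging over the first `k` coordinates does not change the joint law of `φ(Xⁿ)` and any later
coordinate. -/
lemma prodMean_condProb_mul {q : X → ℝ} (hq : ∑ a, q a = 1) {n : ℕ} (φ : (Fin n → X) → J) (j : J)
    {k : ℕ} (G : (Fin n → X) → ℝ)
    (hG : ∀ i : Fin n, (i : ℕ) < k → ∀ x a, G (Function.update x i a) = G x) :
    prodMean q (fun x => condProb q φ j k x * G x)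
      = prodMean q fun x => (if φ x = j then 1 else 0) * G x := by
  induction k with
  | zero => rfl
  | succ k ih =>
    rw [← ih fun i hi => hG i (by omega)]
    by_cases h : k < n
    · rw [← prodMean_coordMean hq ⟨k, h⟩ fun x => condProb q φ j k x * G x]
      congr 1
      funext x
      simp only [condProb, h, dif_pos, coordMean, Finset.sum_mul,
        hG ⟨k, h⟩ (Nat.lt_succ_self k), mul_assoc]
    · simp only [condProb, h, dif_neg, not_false_eq_true]

/-- Gibbs' inequality. -/
lemma sum_mul_log_le_sum_mul_log {J : Type*} [Fintype J] {p r : J → ℝ} (hp : ∀ j, 0 ≤ p j)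
    (hr : ∀ j, 0 < r j) (hsum : ∑ j, r j ≤ ∑ j, p j) :
    ∑ j, p j * Real.log (r j) ≤ ∑ j, p j * Real.log (p j) := by
  have h1 : ∀ j, p j * Real.log (r j) - p j * Real.log (p j) ≤ r j - p j := by
    intro j
    rcases eq_or_lt_of_le (hp j) with h | h
    · simp [← h, (hr j).le]
    · have h2 := Real.log_le_sub_one_of_pos (div_pos (hr j) h)
      rw [Real.log_div (hr j).ne' h.ne'] at h2
      have h3 := mul_le_mul_of_nonneg_left h2 h.le
      have h4 : p j * (r j / p j - 1) = r j - p j := by field_simp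
      linarith
  have h2 := Finset.sum_le_sum fun j (_ : j ∈ Finset.univ) => h1 j
  rw [Finset.sum_sub_distrib, Finset.sum_sub_distrib] at h2
  linarith

lemma mul_log_div_eq {a b c : ℝ} (h : b = 0 → c * a = 0) :
    c * (a * Real.log (a / b)) = c * (a * Real.log a) - c * a * Real.log b := by
  by_cases hb : b = 0
  · rcases mul_eq_zero.1 (h hb) with h | h <;> simp [h]
  · by_cases ha : a = 0
    · simp [ha]
    · rw [Real.log_div ha hb]; ring

variable {Y : Type*} [MeasurableSpace X] [MeasurableSpace Y] [MeasurableSingletonClass X]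

/-- `rateDistortion_le_of_density_le` for a finite auxiliary alphabet. -/
lemma rateDistortion_le_of_finite {Z : Type*} [Fintype Z] {d : X → Y → ℝ} {dmax D : ℝ}
    (hd : ∀ x y, 0 ≤ d x y ∧ d x y ≤ dmax) (hmeas : ∀ x, Measurable (d x))
    (Q : ProbabilityMeasure X) (π : Z → Y) {v : X → Z → ℝ} (hv0 : ∀ x z, 0 ≤ v x z)
    (hv1 : ∀ x, ∑ z, v x z = 1) {m : Z → ℝ} (hm0 : ∀ z, 0 ≤ m z) (hm1 : ∑ z, m z = 1)
    (g : X → Z → ℝ) (hg : ∀ x z, mass Q x ≠ 0 → v x z ≤ Real.exp (g x z) * m z)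
    (hdist : ∑ x, mass Q x * ∑ z, v x z * d x (π z) ≤ D) :
    rateDistortion d D Q ≤ ENNReal.ofReal (∑ x, mass Q x * ∑ z, v x z * g x z) := by
  let _ : MeasurableSpace Z := ⊤
  have hV : ∀ x, IsProbabilityMeasure (ofWeights (v x)) := fun x =>
    isProbabilityMeasure_ofWeights (hv0 x) (hv1 x)
  have hM := isProbabilityMeasure_ofWeights hm0 hm1
  have h := rateDistortion_le_of_density_le hd hmeas Q (π := π) Measurable.of_discrete
    (fun x => ofWeights (v x)) (ofWeights m) (g := g) (fun _ => Measurable.of_discrete)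
    (C := ∑ x, ∑ z, |g x z|) (fun x z => ?_) (fun x hx => ?_) (D := D) ?_
  · simpa only [integral_ofWeights (hv0 _)] using h
  · calc |g x z| ≤ ∑ z, |g x z| :=
          Finset.single_le_sum (f := fun z => |g x z|) (fun _ _ => abs_nonneg _)
            (Finset.mem_univ z)
      _ ≤ ∑ x, ∑ z, |g x z| :=
          Finset.single_le_sum (f := fun x => ∑ z, |g x z|)
            (fun _ _ => Finset.sum_nonneg fun _ _ => abs_nonneg _) (Finset.mem_univ x)
  · have hsum : (ofWeights m).withDensity (fun z => ENNReal.ofReal (Real.exp (g x z)))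
        = ∑ z, ENNReal.ofReal (Real.exp (g x z) * m z) • Measure.dirac z := by
      rw [ofWeights, ← Measure.sum_fintype, withDensity_sum, Measure.sum_fintype]
      refine Finset.sum_congr rfl fun z _ => ?_
      rw [withDensity_smul_measure, dirac_withDensity, smul_smul, mul_comm,
        ENNReal.ofReal_mul (Real.exp_pos _).le]
    rw [hsum]
    refine Finset.sum_le_sum fun z _ => ?_
    gcongr
    exact hg x z hx
  · simpa only [integral_ofWeights (hv0 _)] using hdist

/-- The single-letter bound: a function `φ` of `n` independent letters from which they can be
reproduced with mean distortion at most `D` costs at least `n R(D, Q)` nats in any prefix code,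
whose code lengths are here `-log (r j)`.

The proof exhibits a test channel. For an input `x`, it draws a position `k`, independent letters
`x'`, and then a value `j` of `φ` given that the coordinates from the `k`-th on are those of `x'`
with `x` in the place `k`; the output is the `k`-th letter of the reproduction `yhat j`. By the
chain rule, a telescoping sum, its information cost is `1/n` times the entropy of `φ`. Drawing the
position `k` at random replaces the convexity of the rate-distortion function. -/
lemma rateDistortion_le_codeLength [Fintype J] {d : X → Y → ℝ} {dmax D : ℝ}
    (hd : ∀ x y, 0 ≤ d x y ∧ d x y ≤ dmax) (hmeas : ∀ x, Measurable (d x))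
    (Q : ProbabilityMeasure X) {n : ℕ} (hn : 0 < n) (φ : (Fin n → X) → J) (yhat : J → Fin n → Y)
    (hdist : prodMean (mass Q) (fun x => meanDistortion d x (yhat (φ x))) ≤ D)
    {r : J → ℝ} (hr : ∀ j, 0 < r j) (hr1 : ∑ j, r j ≤ 1) :
    rateDistortion d D Q ≤
      ENNReal.ofReal ((1 / (n : ℝ)) * prodMean (mass Q) fun x => -Real.log (r (φ x))) := by
  classical
  set q := mass Q with hqdef
  have hq0 : ∀ a, 0 ≤ q a := mass_nonneg Q
  have hq1 : ∑ a, q a = 1 := sum_mass Q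
  have hn' : (0 : ℝ) < n := by exact_mod_cast hn
  set w : (Fin n → X) → ℝ := fun x => ∏ i, q (x i) with hw
  have hw0 : ∀ x, 0 ≤ w x := fun x => Finset.prod_nonneg fun i _ => hq0 _
  have hw1 : ∑ x, w x = 1 := by simpa [prodMean] using prodMean_one hq1 n
  set c := condProb q φ with hc
  have hc0 : ∀ j k x, 0 ≤ c j k x := fun j k x => condProb_nonneg hq0 φ j k x
  have hcs : ∀ (k : Fin n) j x, c j (k + 1) x = ∑ a, q a * c j k (Function.update x k a) :=
    fun k j x => by rw [hc, condProb_succ]; rfl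
  have hzero : ∀ (k : Fin n) j x a, c j (k + 1) x = 0 →
      q a * c j k (Function.update x k a) = 0 := by
    intro k j x a h
    rw [hcs, Finset.sum_eq_zero_iff_of_nonneg fun a _ => mul_nonneg (hq0 a) (hc0 _ _ _)] at h
    exact h a (Finset.mem_univ a)
  let v : X → (Fin n × (Fin n → X)) × J → ℝ := fun x z =>
    (1 / (n : ℝ)) * (w z.1.2 * c z.2 z.1.1 (Function.update z.1.2 z.1.1 x))
  let m : (Fin n × (Fin n → X)) × J → ℝ := fun z =>
    (1 / (n : ℝ)) * (w z.1.2 * c z.2 (z.1.1 + 1) z.1.2)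
  let g : X → (Fin n × (Fin n → X)) × J → ℝ := fun x z =>
    Real.log (c z.2 z.1.1 (Function.update z.1.2 z.1.1 x) / c z.2 (z.1.1 + 1) z.1.2)
  have hone : (1 / (n : ℝ)) * n = 1 := by field_simp
  -- Means under the test channel, for the costs and for the distortion alike: `f` may depend on the
  -- input, the position, the value `j`, and its conditional probabilities with and without the input.
  have key : ∀ f : X → Fin n → J → ℝ → ℝ → ℝ,
      ∑ x, q x * ∑ z : (Fin n × (Fin n → X)) × J, v x z * f x z.1.1 z.2
        (c z.2 z.1.1 (Function.update z.1.2 z.1.1 x)) (c z.2 (z.1.1 + 1) z.1.2)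
      = (1 / (n : ℝ)) * ∑ k : Fin n, prodMean q fun x' => ∑ j, ∑ x,
        q x * (c j k (Function.update x' k x) *
          f x k j (c j k (Function.update x' k x)) (c j (k + 1) x')) := by
    intro f
    simp only [Fintype.sum_prod_type, prodMean, Finset.mul_sum, v]
    rw [Finset.sum_comm]
    refine Finset.sum_congr rfl fun k _ => ?_
    rw [Finset.sum_comm]
    refine Finset.sum_congr rfl fun x' _ => ?_
    rw [Finset.sum_comm]
    refine Finset.sum_congr rfl fun j _ => Finset.sum_congr rfl fun x _ => ?_
    simp only [hw]
    ring
  have hbound := rateDistortion_le_of_finite hd hmeas Q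
    (π := fun z : (Fin n × (Fin n → X)) × J => yhat z.2 z.1.1) (v := v)
    (fun x z => by
      have := hw0 z.1.2
      have := hc0 z.2 z.1.1 (Function.update z.1.2 z.1.1 x)
      positivity)
    (fun x => ?_) (m := m)
    (fun z => by have := hw0 z.1.2; have := hc0 z.2 (z.1.1 + 1) z.1.2; positivity) ?_ g
    (fun x z hx => ?_) (D := D) ?_
  · refine hbound.trans (ENNReal.ofReal_le_ofReal ?_)
    have h1 := key fun _ _ _ a b => Real.log (a / b)
    refine h1.trans_le ?_
    set H : ℕ → ℝ := fun k => prodMean q fun x => ∑ j, c j k x * Real.log (c j k x) with hH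
    have h2 : ∀ k : Fin n, (prodMean q fun x' => ∑ j, ∑ x, q x * (c j k (Function.update x' k x) *
        Real.log (c j k (Function.update x' k x) / c j (k + 1) x'))) = H k - H (k + 1) := by
      intro k
      have h3 : ∀ x', (∑ j, ∑ x, q x * (c j k (Function.update x' k x) *
          Real.log (c j k (Function.update x' k x) / c j (k + 1) x')))
          = coordMean q k (fun x => ∑ j, c j k x * Real.log (c j k x)) x'
            - ∑ j, c j (k + 1) x' * Real.log (c j (k + 1) x') := by
        intro x'
        have h4 : coordMean q k (fun x => ∑ j, c j k x * Real.log (c j k x)) x'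
            = ∑ j, ∑ x, q x * (c j k (Function.update x' k x) *
              Real.log (c j k (Function.update x' k x))) := by
          simp_rw [coordMean, Finset.mul_sum]
          exact Finset.sum_comm
        rw [h4, ← Finset.sum_sub_distrib]
        refine Finset.sum_congr rfl fun j _ => ?_
        conv_rhs => rw [hcs k j x', Finset.sum_mul, ← Finset.sum_sub_distrib, ← hcs k j x']
        exact Finset.sum_congr rfl fun x _ => mul_log_div_eq (hzero k j x' x)
      simp_rw [h3]
      rw [prodMean_sub, prodMean_coordMean hq1]
    simp_rw [h2]
    rw [Fin.sum_univ_eq_sum_range (fun k => H k - H (k + 1)) n, Finset.sum_range_sub']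
    have h0 : H 0 = 0 := by
      have : ∀ x, ∑ j, c j 0 x * Real.log (c j 0 x) = 0 := fun x =>
        Finset.sum_eq_zero fun j _ => by
          simp only [hc, condProb]
          split_ifs <;> simp
      simp [hH, this, prodMean]
    have hn1 : -H n ≤ prodMean q fun x => -Real.log (r (φ x)) := by
      have h5 : ∀ x, ∑ j, c j n x * Real.log (r j) ≤ ∑ j, c j n x * Real.log (c j n x) := fun x =>
        sum_mul_log_le_sum_mul_log (fun j => hc0 j n x) hr (by rw [hc, sum_condProb hq1]; exact hr1)
      have h6 := prodMean_mono hq0 fun x _ => h5 x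
      have h7 : (prodMean q fun x => ∑ j, c j n x * Real.log (r j))
          = prodMean q fun x => Real.log (r (φ x)) := by
        rw [prodMean_sum]
        have h8 : ∀ j, (prodMean q fun x => c j n x * Real.log (r j))
            = prodMean q fun x => (if φ x = j then 1 else 0) * Real.log (r j) := by
          intro j
          exact prodMean_condProb_mul hq1 φ j (fun _ => Real.log (r j)) fun _ _ _ _ => rfl
        simp_rw [h8]
        rw [← prodMean_sum]
        simp
      have h9 : (prodMean q fun x => -Real.log (r (φ x)))
          = -prodMean q fun x => Real.log (r (φ x)) := by
        simp [prodMean]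
      rw [h9, ← h7]
      linarith
    rw [h0, zero_sub]
    gcongr
  · simp only [v, Fintype.sum_prod_type, ← Finset.mul_sum, hc, sum_condProb hq1, mul_one, hw1]
    simpa using hone
  · simp only [m, Fintype.sum_prod_type, ← Finset.mul_sum, hc, sum_condProb hq1, mul_one, hw1]
    simpa using hone
  · simp only [v, m, g]
    have h1 := hc0 z.2 z.1.1 (Function.update z.1.2 z.1.1 x)
    have h2 := hc0 z.2 (z.1.1 + 1) z.1.2
    have h3 := hw0 z.1.2
    rcases eq_or_lt_of_le h1 with h1 | h1
    · rw [← h1]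
      simp only [mul_zero]
      positivity
    · rcases eq_or_lt_of_le h2 with h2 | h2
      · have := (mul_eq_zero.1 (hzero z.1.1 z.2 z.1.2 x h2.symm)).resolve_left hx
        exact absurd this h1.ne'
      · rw [Real.exp_log (div_pos h1 h2)]
        refine le_of_eq ?_
        field_simp
  · have h1 := key fun x k j _ _ => d x (yhat j k)
    refine h1.trans_le (le_trans (le_of_eq ?_) hdist)
    have h2 : ∀ k : Fin n, (prodMean q fun x' => ∑ j, ∑ x,
        q x * (c j k (Function.update x' k x) * d x (yhat j k)))
        = prodMean q fun x => d (x k) (yhat (φ x) k) := by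
      intro k
      rw [prodMean_sum]
      have h3 : ∀ j, (prodMean q fun x' => ∑ x,
          q x * (c j k (Function.update x' k x) * d x (yhat j k)))
          = prodMean q fun x => (if φ x = j then 1 else 0) * d (x k) (yhat j k) := by
        intro j
        rw [← prodMean_condProb_mul hq1 φ j (k := k) (fun x => d (x k) (yhat j k)),
          ← prodMean_coordMean hq1 k fun x => condProb q φ j k x * d (x k) (yhat j k)]
        · congr 1
          funext x'
          simp only [coordMean, Function.update_self, hc]
        · intro i hi x a
          rw [Function.update_of_ne]
          intro h
          rw [h] at hi
          exact lt_irrefl _ hi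
      simp_rw [h3]
      rw [← prodMean_sum]
      simp
    simp_rw [h2]
    rw [← prodMean_sum, ← prodMean_mul_left]
    rfl

end SingleLetter

/-! ### The lower bound for every strategy -/

section Converse

variable {X Y : Type*}

lemma exists_of_guessCount_ne_top {d : X → Y → ℝ} {D : ℝ} {n : ℕ} {S : Strategy Y n}
    {x : Fin n → X} (h : guessCount d D S x ≠ ⊤) :
    ∃ j y, guessCount d D S x = ((j + 1 : ℕ) : ℕ∞) ∧ S.guesses.get? j = some y ∧
      meanDistortion d x y ≤ D := by
  classical
  have hex : ∃ j, ∃ y, S.guesses.get? j = some y ∧ meanDistortion d x y ≤ D := by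
    by_contra hne
    push Not at hne
    refine h ?_
    rw [guessCount, iInf_eq_top]
    intro j
    rw [iInf_eq_top]
    rintro ⟨y, hy, hy'⟩
    exact absurd hy' (not_le.2 (hne j y hy))
  obtain ⟨y, hy⟩ := Nat.find_spec hex
  refine ⟨Nat.find hex, y, le_antisymm ?_ ?_, hy⟩
  · exact iInf₂_le (Nat.find hex) (Nat.find_spec hex)
  · refine le_iInf₂ fun j hj => ?_
    have := Nat.find_min' hex hj
    exact_mod_cast Nat.succ_le_succ this

lemma sum_inv_le_one_add_log {s : Finset ℕ} (hs : ∀ j ∈ s, 1 ≤ j) :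
    ∑ j ∈ s, (1 : ℝ) / j ≤ 1 + Real.log s.card := by
  refine le_trans ?_ (harmonic_le_one_add_log s.card)
  rw [harmonic, Rat.cast_sum]
  induction s using Finset.induction_on_max with
  | empty => simp
  | insert a s hmax ih =>
    have ha : a ∉ s := fun h => lt_irrefl _ (hmax a h)
    rw [Finset.sum_insert ha, Finset.card_insert_of_notMem ha, Finset.sum_range_succ, add_comm]
    refine add_le_add (ih fun j hj => hs j (Finset.mem_insert_of_mem hj)) ?_
    have hcard : s.card + 1 ≤ a := by
      have hsub : s ⊆ Finset.Ico 1 a := fun j hj =>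
        Finset.mem_Ico.2 ⟨hs j (Finset.mem_insert_of_mem hj), hmax j hj⟩
      have h1 := Finset.card_le_card hsub
      rw [Nat.card_Ico] at h1
      have := hs a (Finset.mem_insert_self a s)
      omega
    push_cast
    rw [one_div]
    gcongr
    exact_mod_cast hcard

variable [Fintype X]

/-- The relative entropy of two weight functions on a finite type, with the convention
`0 log (0/p) = 0`; it agrees with the divergence if `q` vanishes wherever `p` does. -/
def relEntropy (q p : X → ℝ) : ℝ := ∑ x, q x * Real.log (q x / p x)

lemma prodMean_coord {q : X → ℝ} (hq : ∑ a, q a = 1) {n : ℕ} (i : Fin n) (f : X → ℝ) :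
    prodMean q (fun x => f (x i)) = ∑ a, q a * f a := by
  have h : coordMean q i (fun x => f (x i)) = fun _ => (∑ a, q a * f a) * 1 := by
    funext x
    simp [coordMean]
  rw [← prodMean_coordMean hq i, h, prodMean_mul_left, prodMean_one hq, mul_one]

/-- Change of measure, by Jensen's inequality: under `Qⁿ` the mean of `log G` exceeds the logarithm
of the mean of `G` under `Pⁿ` by at most `n D(Q‖P)`. -/
lemma prodMean_log_le {q p : X → ℝ} (hq0 : ∀ a, 0 ≤ q a) (hq1 : ∑ a, q a = 1) (hp0 : ∀ a, 0 ≤ p a)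
    (hqp : ∀ a, p a = 0 → q a = 0) {n : ℕ} {G : (Fin n → X) → ℝ} (hG : ∀ x, 0 < G x)
    (hpos : 0 < prodMean p G) :
    prodMean q (fun x => Real.log (G x)) ≤ Real.log (prodMean p G) + n * relEntropy q p := by
  set e := prodMean p G with he
  have hent : prodMean q (fun x : Fin n → X => ∑ i, Real.log (q (x i) / p (x i)))
      = n * relEntropy q p := by
    rw [prodMean_sum, Finset.sum_congr rfl fun i _ => prodMean_coord hq1 i fun a =>
      Real.log (q a / p a)]
    simp [relEntropy]
  have hterm : ∀ x : Fin n → X, (∏ i, q (x i)) *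
      (Real.log (G x) - ∑ i, Real.log (q (x i) / p (x i)) - Real.log e)
        ≤ (∏ i, p (x i)) * G x / e - (∏ i, q (x i)) * 1 := by
    intro x
    have hP : 0 ≤ ∏ i, p (x i) := Finset.prod_nonneg fun i _ => hp0 _
    by_cases hx : ∏ i, q (x i) = 0
    · rw [hx]
      simp only [zero_mul, sub_zero]
      have := (hG x).le
      positivity
    · have hqi : ∀ i, q (x i) ≠ 0 := fun i => (Finset.prod_ne_zero_iff.1 hx) i (Finset.mem_univ i)
      have hpi : ∀ i, p (x i) ≠ 0 := fun i h => hqi i (hqp _ h)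
      have hPpos : 0 < ∏ i, p (x i) :=
        Finset.prod_pos fun i _ => lt_of_le_of_ne (hp0 _) (hpi i).symm
      have hQpos : 0 < ∏ i, q (x i) :=
        Finset.prod_pos fun i _ => lt_of_le_of_ne (hq0 _) (hqi i).symm
      have h1 : ∑ i, Real.log (q (x i) / p (x i))
          = Real.log (∏ i, q (x i)) - Real.log (∏ i, p (x i)) := by
        rw [Real.log_prod fun i _ => hqi i, Real.log_prod fun i _ => hpi i,
          ← Finset.sum_sub_distrib]
        exact Finset.sum_congr rfl fun i _ => Real.log_div (hqi i) (hpi i)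
      have h2 := Real.log_le_sub_one_of_pos
        (div_pos (div_pos (mul_pos hPpos (hG x)) hpos) hQpos)
      rw [Real.log_div (by have := hG x; positivity) hx,
        Real.log_div (by have := hG x; positivity) hpos.ne',
        Real.log_mul hPpos.ne' (hG x).ne'] at h2
      have h3 := mul_le_mul_of_nonneg_left h2 hQpos.le
      rw [h1]
      refine le_trans (le_of_eq (by ring)) (h3.trans (le_of_eq ?_))
      field_simp
  have hsum := Finset.sum_le_sum fun x (_ : x ∈ Finset.univ) => hterm x
  rw [Finset.sum_sub_distrib, ← Finset.sum_div] at hsum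
  change prodMean q _ ≤ prodMean p G / e - prodMean q (fun _ => 1) at hsum
  rw [prodMean_one hq1, ← he, div_self hpos.ne', sub_self, prodMean_sub, prodMean_sub, hent] at hsum
  have h4 : prodMean q (fun _ : Fin n → X => Real.log e) = Real.log e := by
    simpa [prodMean_one hq1] using prodMean_mul_left q (Real.log e) (fun _ : Fin n → X => 1)
  rw [h4] at hsum
  linarith

variable [MeasurableSpace X] [MeasurableSingletonClass X]

lemma expectedGuesses_eq_sum (P : ProbabilityMeasure X) (d : X → Y → ℝ) (D : ℝ) {n : ℕ}
    (S : Strategy Y n) : expectedGuesses P d D S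
      = ∑ x : Fin n → X, ENNReal.ofReal (∏ i, mass P (x i)) * (guessCount d D S x : ℝ≥0∞) := by
  classical
  rw [expectedGuesses, lintegral_fintype]
  refine Finset.sum_congr rfl fun x _ => ?_
  rw [Measure.pi_singleton, ENNReal.ofReal_prod_of_nonneg fun i _ => mass_nonneg P _, mul_comm]
  simp_rw [ofReal_mass]

/-- The lower bound for every strategy and every block length. The counting function takes at most
`|X|ⁿ` values, so the code for it whose code lengths are `log G + const` has a constant of order
`log n`. -/
lemma le_log_expectedGuesses [MeasurableSpace Y] [Nonempty Y] {d : X → Y → ℝ} {dmax D : ℝ}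
    (hd : ∀ x y, 0 ≤ d x y ∧ d x y ≤ dmax) (hmeas : ∀ x, Measurable (d x))
    (P Q : ProbabilityMeasure X)
    (hQP : ∀ x, mass P x = 0 → mass Q x = 0) {n : ℕ} (hn : 0 < n) (S : Strategy Y n) :
    ((n * ((rateDistortion d D Q).toReal - relEntropy (mass Q) (mass P))
      - Real.log (1 + n * Real.log (Fintype.card X)) : ℝ) : EReal)
      ≤ ENNReal.log (expectedGuesses P d D S) := by
  classical
  have hne : Nonempty X := nonempty_of_probabilityMeasure Q
  by_cases htop : expectedGuesses P d D S = ⊤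
  · rw [htop, ENNReal.log_top]; exact le_top
  have hn' : (0 : ℝ) < n := by exact_mod_cast hn
  set p := mass P with hp
  set q := mass Q with hq
  have hq0 : ∀ a, 0 ≤ q a := mass_nonneg Q
  have hq1 : ∑ a, q a = 1 := sum_mass Q
  have hp0 : ∀ a, 0 ≤ p a := mass_nonneg P
  have hp1 : ∑ a, p a = 1 := sum_mass P
  -- The maximum only affects sequences of probability zero, where `toNat` may turn `⊤` into `0`.
  set G : (Fin n → X) → ℕ := fun x => max 1 (guessCount d D S x).toNat with hG
  have hG1 : ∀ x, 1 ≤ G x := fun x => le_max_left _ _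
  have hGpos : ∀ x, (0 : ℝ) < G x := fun x => by exact_mod_cast hG1 x
  have hfin : ∀ x, ∏ i, p (x i) ≠ 0 → guessCount d D S x ≠ ⊤ := by
    intro x hx hx'
    refine htop (top_le_iff.1 ?_)
    rw [expectedGuesses_eq_sum]
    refine le_trans (le_of_eq ?_) (Finset.single_le_sum (f := fun x : Fin n → X =>
      ENNReal.ofReal (∏ i, mass P (x i)) * (guessCount d D S x : ℝ≥0∞)) (fun _ _ => zero_le)
      (Finset.mem_univ x))
    rw [hx', ENat.toENNReal_top, ENNReal.mul_top]
    rw [ne_eq, ENNReal.ofReal_eq_zero, not_le]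
    exact lt_of_le_of_ne (Finset.prod_nonneg fun i _ => hp0 _) (Ne.symm hx)
  have hGspec : ∀ x, ∏ i, p (x i) ≠ 0 → guessCount d D S x = ((G x : ℕ) : ℕ∞) ∧
      ∃ y, S.guesses.get? (G x - 1) = some y ∧ meanDistortion d x y ≤ D := by
    intro x hx
    obtain ⟨j, y, h1, h2⟩ := exists_of_guessCount_ne_top (hfin x hx)
    have h3 : G x = j + 1 := by
      have : (guessCount d D S x).toNat = j + 1 := by rw [h1, ENat.toNat_natCast]
      simp only [hG, this]
      omega
    refine ⟨h3 ▸ h1, y, ?_⟩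
    rw [h3]
    exact h2
  have hE : expectedGuesses P d D S = ENNReal.ofReal (prodMean p fun x => (G x : ℝ)) := by
    rw [expectedGuesses_eq_sum, prodMean, ENNReal.ofReal_sum_of_nonneg fun x _ =>
      mul_nonneg (Finset.prod_nonneg fun i _ => hp0 _) (hGpos x).le]
    refine Finset.sum_congr rfl fun x _ => ?_
    rw [ENNReal.ofReal_mul (Finset.prod_nonneg fun i _ => hp0 _)]
    by_cases hx : ∏ i, p (x i) = 0
    · simp [hx, ← hp]
    · rw [(hGspec x hx).1]
      simp [← hp]
  have hEpos : 0 < prodMean p fun x => (G x : ℝ) := by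
    refine lt_of_lt_of_le zero_lt_one ?_
    rw [← prodMean_one hp1 n]
    exact prodMean_mono hp0 fun x _ => by exact_mod_cast hG1 x
  rw [hE, ENNReal.log_ofReal_of_pos hEpos]
  refine EReal.coe_le_coe_iff.2 ?_
  set s : Finset ℕ := Finset.univ.image G with hs
  have hs1 : ∀ j ∈ s, 1 ≤ j := by
    intro j hj
    obtain ⟨x, _, rfl⟩ := Finset.mem_image.1 hj
    exact hG1 x
  let φ : (Fin n → X) → s := fun x => ⟨G x, Finset.mem_image_of_mem _ (Finset.mem_univ x)⟩
  let yhat : s → Fin n → Y := fun j =>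
    (S.guesses.get? ((j : ℕ) - 1)).getD fun _ => Classical.arbitrary Y
  set c : ℝ := ∑ j ∈ s, (1 : ℝ) / j with hc
  have hcpos : 0 < c := by
    obtain ⟨x₀⟩ := (inferInstance : Nonempty (Fin n → X))
    exact Finset.sum_pos (fun j hj => by have := hs1 j hj; positivity)
      ⟨G x₀, Finset.mem_image_of_mem _ (Finset.mem_univ _)⟩
  have hdist : prodMean q (fun x => meanDistortion d x (yhat (φ x))) ≤ D := by
    have h1 : prodMean q (fun _ : Fin n → X => D) = D := by
      simpa [prodMean_one hq1] using prodMean_mul_left q D (fun _ : Fin n → X => 1)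
    rw [← h1]
    refine prodMean_mono hq0 fun x hx => ?_
    have hx' : ∏ i, p (x i) ≠ 0 := by
      rw [Finset.prod_ne_zero_iff] at hx ⊢
      exact fun i hi h => hx i hi (hQP _ h)
    obtain ⟨_, y, hy, hyD⟩ := hGspec x hx'
    simp only [yhat, φ, hy, Option.getD_some]
    exact hyD
  have hR := rateDistortion_le_codeLength hd hmeas Q hn φ yhat hdist (r := fun j => 1 / (c * j))
    (fun j => by
      have : (0 : ℝ) < (j : ℕ) := by exact_mod_cast hs1 j j.2
      positivity)
    (by
      refine le_of_eq ?_
      rw [Finset.sum_coe_sort s fun j : ℕ => 1 / (c * j)]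
      simp_rw [← div_div, div_eq_mul_one_div (1 / c)]
      rw [← Finset.mul_sum, ← hc, one_div_mul_cancel hcpos.ne'])
  have hlen : (prodMean q fun x => -Real.log (1 / (c * (φ x : ℕ))))
      = Real.log c + prodMean q fun x => Real.log (G x) := by
    have h1 : ∀ x, -Real.log (1 / (c * (φ x : ℕ))) = Real.log c * 1 + Real.log (G x) := by
      intro x
      rw [one_div, Real.log_inv, neg_neg, Real.log_mul hcpos.ne' (hGpos x).ne', mul_one]
    simp_rw [h1]
    rw [prodMean_add, prodMean_mul_left, prodMean_one hq1, mul_one]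
  rw [hlen] at hR
  have hlogG : 0 ≤ prodMean q fun x => Real.log (G x) :=
    Finset.sum_nonneg fun x _ => mul_nonneg (Finset.prod_nonneg fun i _ => hq0 _)
      (Real.log_nonneg (by exact_mod_cast hG1 x))
  have hJ := prodMean_log_le hq0 hq1 hp0 hQP hGpos hEpos
  have hc1 : Real.log c ≤ Real.log (1 + n * Real.log (Fintype.card X)) := by
    refine Real.log_le_log hcpos ((sum_inv_le_one_add_log hs1).trans ?_)
    have hcard : s.card ≤ Fintype.card X ^ n := by
      refine Finset.card_image_le.trans (le_of_eq ?_)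
      simp
    rw [← Real.log_pow]
    have : (0 : ℝ) < s.card := by
      have : s.Nonempty := by
        by_contra h
        rw [Finset.not_nonempty_iff_eq_empty] at h
        rw [hc, h] at hcpos
        simp at hcpos
      exact_mod_cast this.card_pos
    gcongr
    exact_mod_cast hcard
  have hlogn : 0 ≤ Real.log (1 + n * Real.log (Fintype.card X)) := by
    have hcx : (1 : ℝ) ≤ Fintype.card X := by exact_mod_cast Fintype.card_pos
    have := Real.log_nonneg hcx
    exact Real.log_nonneg (by nlinarith)
  have hRr : n * (rateDistortion d D Q).toReal
      ≤ Real.log (1 + n * Real.log (Fintype.card X)) + prodMean q fun x => Real.log (G x) := by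
    have h1 : (rateDistortion d D Q).toReal ≤ (1 / (n : ℝ)) *
        (Real.log (1 + n * Real.log (Fintype.card X)) + prodMean q fun x => Real.log (G x)) := by
      refine ENNReal.toReal_le_of_le_ofReal (by positivity) (hR.trans (ENNReal.ofReal_le_ofReal ?_))
      gcongr
    calc _ ≤ (n : ℝ) * ((1 / (n : ℝ)) * _) := mul_le_mul_of_nonneg_left h1 hn'.le
      _ = _ := by rw [← mul_assoc, mul_one_div_cancel hn'.ne', one_mul]
  linarith

end Converse

/-! ### Random sequences near a given sequence -/

section ProductMeasures

variable {Z : Type*} [MeasurableSpace Z]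

lemma pi_withDensity {ι : Type*} [Fintype ι] (ν : Measure Z) [IsProbabilityMeasure ν]
    {f : ι → Z → ℝ≥0∞} (hf : ∀ i, Measurable (f i))
    [∀ i, IsProbabilityMeasure (ν.withDensity (f i))] :
    Measure.pi (fun i => ν.withDensity (f i))
      = (Measure.pi fun _ : ι => ν).withDensity fun z => ∏ i, f i (z i) := by
  classical
  refine Measure.pi_eq fun s hs => ?_
  rw [withDensity_apply _ (MeasurableSet.univ_pi hs), ← lintegral_indicator
    (MeasurableSet.univ_pi hs)]
  have h1 : ∀ z : ι → Z, (Set.univ.pi s).indicator (fun z => ∏ i, f i (z i)) z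
      = ∏ i, (s i).indicator (f i) (z i) := by
    intro z
    by_cases hz : z ∈ Set.univ.pi s
    · rw [Set.indicator_of_mem hz]
      exact Finset.prod_congr rfl fun i _ => (Set.indicator_of_mem (hz i (Set.mem_univ i)) _).symm
    · rw [Set.indicator_of_notMem hz]
      simp only [Set.mem_pi, not_forall] at hz
      obtain ⟨i, _, hi⟩ := hz
      exact (Finset.prod_eq_zero (Finset.mem_univ i) (Set.indicator_of_notMem hi _)).symm
  simp_rw [h1]
  have hm : ∀ i, Measurable ((s i).indicator (f i)) := fun i => (hf i).indicator (hs i)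
  rw [lintegral_prod_eq_prod_lintegral_of_indepFun Finset.univ
    (fun i (z : ι → Z) => (s i).indicator (f i) (z i))
    (iIndepFun_pi fun i => (hm i).aemeasurable) fun i => (hm i).comp (measurable_pi_apply i)]
  refine Finset.prod_congr rfl fun i _ => ?_
  rw [withDensity_apply _ (hs i), ← lintegral_indicator (hs i)]
  exact (measurePreserving_eval (fun _ : ι => ν) i).lintegral_comp (hm i)

lemma exists_density_le {V ν : Measure Z} [IsProbabilityMeasure V] [IsProbabilityMeasure ν]
    {G : Z → ℝ≥0∞} (hG : Measurable G) (h : V ≤ ν.withDensity G) :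
    ∃ f : Z → ℝ≥0∞, Measurable f ∧ f ≤ G ∧ V = ν.withDensity f := by
  have hac : V ≪ ν := (Measure.absolutelyContinuous_of_le h).trans
    (withDensity_absolutelyContinuous _ _)
  have hm := Measure.measurable_rnDeriv V ν
  have hle : V.rnDeriv ν ≤ᵐ[ν] G := by
    refine ae_le_of_forall_setLIntegral_le_of_sigmaFinite hm fun s hs _ => ?_
    rw [Measure.setLIntegral_rnDeriv hac, ← withDensity_apply _ hs]
    exact h s
  refine ⟨fun z => min (V.rnDeriv ν z) (G z), hm.min hG, fun z => min_le_right _ _, ?_⟩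
  conv_lhs => rw [← Measure.withDensity_rnDeriv_eq V ν hac]
  refine withDensity_congr_ae ?_
  filter_upwards [hle] with z hz
  exact (min_eq_left hz).symm

/-- Change of measure on product spaces: where the sum of the logarithmic densities is at most `c`,
the product law is at most `exp c` times the reference law. -/
lemma pi_le_exp_mul_pi {n : ℕ} {V : Fin n → Measure Z} [∀ i, IsProbabilityMeasure (V i)]
    {ν : Measure Z} [IsProbabilityMeasure ν] {g : Fin n → Z → ℝ} (hg : ∀ i, Measurable (g i))
    (hV : ∀ i, V i ≤ ν.withDensity fun z => ENNReal.ofReal (Real.exp (g i z))) {c : ℝ}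
    {A : Set (Fin n → Z)} (hA : MeasurableSet A) (hAc : ∀ z ∈ A, ∑ i, g i (z i) ≤ c) :
    Measure.pi V A ≤ ENNReal.ofReal (Real.exp c) * Measure.pi (fun _ => ν) A := by
  have hex : ∀ i, ∃ f : Z → ℝ≥0∞, Measurable f ∧
      (f ≤ fun z => ENNReal.ofReal (Real.exp (g i z))) ∧ V i = ν.withDensity f := fun i =>
    exists_density_le (by have := hg i; fun_prop) (hV i)
  choose f hfm hfg hVf using hex
  have : ∀ i, IsProbabilityMeasure (ν.withDensity (f i)) := fun i => hVf i ▸ inferInstance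
  have hVeq : V = fun i => ν.withDensity (f i) := funext hVf
  have h1 : Measure.pi V = (Measure.pi fun _ => ν).withDensity fun z => ∏ i, f i (z i) := by
    rw [hVeq]
    exact pi_withDensity ν hfm
  rw [h1, withDensity_apply _ hA, ← setLIntegral_const]
  refine setLIntegral_mono measurable_const fun z hz => ?_
  calc ∏ i, f i (z i) ≤ ∏ i, ENNReal.ofReal (Real.exp (g i (z i))) :=
        Finset.prod_le_prod' fun i _ => hfg i (z i)
    _ = ENNReal.ofReal (Real.exp (∑ i, g i (z i))) := by
        rw [Real.exp_sum, ENNReal.ofReal_prod_of_nonneg fun i _ => (Real.exp_pos _).le]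
    _ ≤ ENNReal.ofReal (Real.exp c) :=
        ENNReal.ofReal_le_ofReal (Real.exp_le_exp.2 (hAc z hz))

/-- Chebyshev's inequality for a sum of independent bounded functions. -/
lemma pi_sum_ge_le {n : ℕ} (hn : 0 < n) {V : Fin n → Measure Z} [∀ i, IsProbabilityMeasure (V i)]
    {f : Fin n → Z → ℝ} (hf : ∀ i, Measurable (f i)) {B : ℝ} (hB : ∀ i z, |f i z| ≤ B)
    {m δ : ℝ} (hδ : 0 < δ) (hm : ∑ i, ∫ z, f i z ∂V i ≤ n * m) :
    Measure.pi V {z | n * (m + δ) ≤ ∑ i, f i (z i)} ≤ ENNReal.ofReal (B ^ 2 / (n * δ ^ 2)) := by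
  have hn' : (0 : ℝ) < n := by exact_mod_cast hn
  set F : (Fin n → Z) → ℝ := ∑ i, fun z => f i (z i) with hF
  have hFz : ∀ z, F z = ∑ i, f i (z i) := fun z => by simp [hF]
  have hmem : ∀ i, MemLp (f i) 2 (V i) := fun i =>
    MemLp.of_bound (hf i).aestronglyMeasurable B (ae_of_all _ (hB i))
  have hFm : Measurable F := by
    have : F = fun z => ∑ i, f i (z i) := funext hFz
    rw [this]
    exact Finset.measurable_sum _ fun i _ => (hf i).comp (measurable_pi_apply i)
  have hFB : ∀ z, ‖F z‖ ≤ n * B := fun z => by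
    rw [hFz, Real.norm_eq_abs]
    refine (Finset.abs_sum_le_sum_abs _ _).trans ((Finset.sum_le_sum fun i _ => hB i (z i)).trans
      (le_of_eq (by simp)))
  have hint : ∫ z, F z ∂Measure.pi V ≤ n * m := by
    have hi : ∀ i, Integrable (fun z : Fin n → Z => f i (z i)) (Measure.pi V) := fun i =>
      integrable_of_bounded ((hf i).comp (measurable_pi_apply i)) fun z => hB i (z i)
    simp_rw [hFz]
    rw [integral_finsetSum _ fun i _ => hi i]
    refine le_of_eq_of_le (Finset.sum_congr rfl fun i _ => ?_) hm
    exact integral_comp_eval (hf i).aestronglyMeasurable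
  have hvar : Var[F; Measure.pi V] ≤ n * B ^ 2 := by
    rw [hF, variance_sum_pi hmem]
    refine (Finset.sum_le_sum fun i _ => ?_).trans (le_of_eq (by simp : ∑ _ : Fin n, B ^ 2 = _))
    have h1 := variance_le_sq_of_bounded (μ := V i) (a := -B) (b := B) (X := f i)
      (ae_of_all _ fun z => abs_le.1 (hB i z)) (hf i).aemeasurable
    refine h1.trans (le_of_eq (by ring))
  have hmemF : MemLp F 2 (Measure.pi V) :=
    MemLp.of_bound hFm.aestronglyMeasurable (n * B) (ae_of_all _ hFB)
  have hc := meas_ge_le_variance_div_sq hmemF (mul_pos hn' hδ)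
  refine (measure_mono fun z hz => ?_).trans (hc.trans (ENNReal.ofReal_le_ofReal ?_))
  · simp only [Set.mem_ofPred_eq] at hz ⊢
    rw [← hFz] at hz
    refine le_trans ?_ (le_abs_self _)
    linarith
  · rw [div_le_div_iff₀ (by positivity) (by positivity)]
    have h2 : Var[F; Measure.pi V] * (n * δ ^ 2) ≤ n * B ^ 2 * (n * δ ^ 2) := by gcongr
    refine h2.trans (le_of_eq (by ring))

end ProductMeasures

section Balls

variable {X Y Z : Type*} [MeasurableSpace Y] [MeasurableSpace Z]

/-- The sequences within distortion `D` of `x`. -/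
def distortionBall (d : X → Y → ℝ) (D : ℝ) {n : ℕ} (x : Fin n → X) : Set (Fin n → Y) :=
  {y | meanDistortion d x y ≤ D}

lemma measurableSet_distortionBall {d : X → Y → ℝ} (hmeas : ∀ x, Measurable (d x)) (D : ℝ) {n : ℕ}
    (x : Fin n → X) : MeasurableSet (distortionBall d D x) := by
  have : Measurable fun y : Fin n → Y => meanDistortion d x y := by
    unfold meanDistortion
    exact (Finset.measurable_sum _ fun i _ =>
      (hmeas (x i)).comp (measurable_pi_apply i)).const_mul _
  exact measurableSet_le this measurable_const

/-- If a test channel has mean cost at most `c` and mean distortion below `D` along the sequence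
`x`, then a random sequence drawn from the reference law hits the ball around `x` with probability at
least about `exp (-n c)`. The block length from which this holds is independent of `x`. -/
lemma TestChannel.le_measure_distortionBall (T : TestChannel X Z) {d : X → Y → ℝ} {dmax D : ℝ}
    (hd : ∀ x y, 0 ≤ d x y ∧ d x y ≤ dmax) (hmeas : ∀ x, Measurable (d x)) (hD : 0 ≤ D)
    {π : Z → Y} (hπ : Measurable π) {δ : ℝ} (hδ : 0 < δ) (c : ℝ) :
    ∃ N, ∀ n ≥ N, ∀ x : Fin n → X, ∑ i, ∫ z, T.cost (x i) z ∂T.law (x i) ≤ n * c →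
      (∑ i, ∫ z, d (x i) (π z) ∂T.law (x i) ≤ n * (D - δ) ∨
        ∀ a, ∀ᵐ z ∂T.law a, d a (π z) = 0) →
      ENNReal.ofReal (Real.exp (-(n * (c + δ))) / 2) ≤
        (Measure.pi fun _ : Fin n => T.ref).map (fun z i => π (z i)) (distortionBall d D x) := by
  obtain ⟨N, hN⟩ := exists_nat_gt (4 * (T.bound ^ 2 + dmax ^ 2) / δ ^ 2)
  refine ⟨max N 1, fun n hn x hcost hdist => ?_⟩
  have hn0 : 0 < n := lt_of_lt_of_le Nat.one_pos ((le_max_right _ _).trans hn)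
  have hn' : (0 : ℝ) < n := by exact_mod_cast hn0
  have hnN : 4 * (T.bound ^ 2 + dmax ^ 2) < n * δ ^ 2 := by
    rw [div_lt_iff₀ (by positivity)] at hN
    have : (N : ℝ) ≤ n := by exact_mod_cast (le_max_left _ _).trans hn
    nlinarith [sq_nonneg δ]
  have hquarter : ∀ B : ℝ, B ^ 2 ≤ T.bound ^ 2 + dmax ^ 2 → B ^ 2 / (n * δ ^ 2) ≤ 1 / 4 := by
    intro B hB
    rw [div_le_div_iff₀ (by positivity) (by norm_num)]
    linarith
  set V : Fin n → Measure Z := fun i => T.law (x i) with hV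
  have hVp : ∀ i, IsProbabilityMeasure (V i) := fun i => T.isProbabilityMeasure_law (x i)
  have hπn : Measurable fun (z : Fin n → Z) i => π (z i) :=
    measurable_pi_lambda _ fun i => hπ.comp (measurable_pi_apply i)
  have hball : MeasurableSet ((fun (z : Fin n → Z) i => π (z i)) ⁻¹' distortionBall d D x) :=
    hπn (measurableSet_distortionBall hmeas D x)
  rw [Measure.map_apply hπn (measurableSet_distortionBall hmeas D x)]
  set E := (fun (z : Fin n → Z) i => π (z i)) ⁻¹' distortionBall d D x with hE
  set C : Set (Fin n → Z) := {z | n * (c + δ) ≤ ∑ i, T.cost (x i) (z i)} with hC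
  have hCm : MeasurableSet C := measurableSet_le measurable_const
    (Finset.measurable_sum _ fun i _ =>
      (T.measurable_cost (x i)).comp (measurable_pi_apply i))
  have hCle : Measure.pi V C ≤ ENNReal.ofReal (1 / 4) :=
    (pi_sum_ge_le hn0 (fun i => T.measurable_cost (x i)) (fun i z => T.abs_cost_le (x i) z) hδ
      hcost).trans (ENNReal.ofReal_le_ofReal (hquarter _ (by nlinarith [sq_nonneg dmax])))
  have hEle : Measure.pi V Eᶜ ≤ ENNReal.ofReal (1 / 4) := by
    rcases hdist with hdist | hdist
    · refine (measure_mono fun z hz => ?_).trans ((pi_sum_ge_le hn0 (V := V)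
        (f := fun i z => d (x i) (π z)) (fun i => (hmeas (x i)).comp hπ) (B := dmax)
        (fun i z => by rw [abs_of_nonneg (hd _ _).1]; exact (hd _ _).2) hδ hdist).trans
        (ENNReal.ofReal_le_ofReal (hquarter _ (by nlinarith [sq_nonneg T.bound]))))
      simp only [hE, distortionBall, meanDistortion, Set.mem_compl_iff, Set.mem_preimage,
        Set.mem_ofPred_eq, not_le] at hz ⊢
      rw [sub_add_cancel]
      rw [one_div, inv_mul_eq_div, lt_div_iff₀ hn'] at hz
      linarith
    · have hae : ∀ᵐ z ∂Measure.pi V, ∀ i, d (x i) (π (z i)) = 0 := by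
        rw [ae_all_iff]
        intro i
        exact (Measure.tendsto_eval_ae_ae (μ := V) (i := i)).eventually (hdist (x i))
      have h0 : Measure.pi V Eᶜ = 0 := by
        rw [← mem_ae_iff]
        filter_upwards [hae] with z hz
        simp [hE, distortionBall, meanDistortion, hz, hD]
      rw [h0]
      exact zero_le
  have hA : ENNReal.ofReal (1 / 2) ≤ Measure.pi V (E \ C) := by
    have h1 : (1 : ℝ≥0∞) ≤ Measure.pi V (E \ C) + (Measure.pi V Eᶜ + Measure.pi V C) := by
      rw [← measure_univ (μ := Measure.pi V)]
      refine (measure_mono fun z _ => ?_).trans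
        ((measure_union_le (E \ C) (Eᶜ ∪ C)).trans (add_le_add le_rfl (measure_union_le _ _)))
      by_cases h1 : z ∈ E <;> by_cases h2 : z ∈ C <;> simp [h1, h2]
    have h2 : Measure.pi V Eᶜ + Measure.pi V C ≤ ENNReal.ofReal (1 / 2) := by
      refine (add_le_add hEle hCle).trans (le_of_eq ?_)
      rw [← ENNReal.ofReal_add (by norm_num) (by norm_num)]
      norm_num
    have h3 : (1 : ℝ≥0∞) = ENNReal.ofReal (1 / 2) + ENNReal.ofReal (1 / 2) := by
      rw [← ENNReal.ofReal_add (by norm_num) (by norm_num)]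
      norm_num
    rw [h3] at h1
    exact (ENNReal.add_le_add_iff_right ENNReal.ofReal_ne_top).1
      (h1.trans (add_le_add le_rfl h2))
  have hch := pi_le_exp_mul_pi (fun i => T.measurable_cost (x i)) (fun i => T.law_le (x i))
    (c := n * (c + δ)) (hball.diff hCm) fun z hz => (not_le.1 hz.2).le
  have h4 : ENNReal.ofReal (1 / 2) ≤ ENNReal.ofReal (Real.exp (n * (c + δ))) *
      Measure.pi (fun _ => T.ref) E :=
    hA.trans (hch.trans (mul_le_mul_right (measure_mono Set.sdiff_subset) _))
  calc ENNReal.ofReal (Real.exp (-(n * (c + δ))) / 2)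
      ≤ ENNReal.ofReal (Real.exp (-(n * (c + δ)))) * ENNReal.ofReal (1 / 2) := by
        rw [← ENNReal.ofReal_mul (Real.exp_pos _).le, mul_one_div]
    _ ≤ ENNReal.ofReal (Real.exp (-(n * (c + δ)))) *
        (ENNReal.ofReal (Real.exp (n * (c + δ))) * Measure.pi (fun _ => T.ref) E) := by
        gcongr
    _ = Measure.pi (fun _ => T.ref) E := by
        rw [← mul_assoc, ← ENNReal.ofReal_mul (Real.exp_pos _).le, ← Real.exp_add]
        simp

end Balls

/-! ### From random guesses to strategies -/

section Strategies

/-- The index, counted from `1`, of the first entry of the list `L` that lies in `B x`; if there is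
none, `N` is added to the length of the list. -/
def firstHit {A Ω : Type*} (B : A → Set Ω) (N : ℝ) : List Ω → A → ℝ
  | [], _ => N
  | y :: L, x =>
    open Classical in
    if y ∈ B x then 1 else 1 + firstHit B N L x

/-- The mean of `firstHit` for `m` independent random entries, each of which hits with
probability `b`. -/
def meanHit (N b : ℝ) : ℕ → ℝ
  | 0 => N
  | m + 1 => 1 + (1 - b) * meanHit N b m

lemma meanHit_le {N b : ℝ} (hb : 0 < b) (hb1 : b ≤ 1) (m : ℕ) :
    meanHit N b m ≤ 1 / b + N * (1 - b) ^ m := by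
  induction m with
  | zero =>
    have : 0 < 1 / b := by positivity
    simp only [meanHit, pow_zero, mul_one]
    linarith
  | succ m ih =>
    have h1 := mul_le_mul_of_nonneg_left ih (sub_nonneg.2 hb1)
    have h2 : 1 + (1 - b) * (1 / b + N * (1 - b) ^ m) = 1 / b + N * (1 - b) ^ (m + 1) := by
      field_simp
      ring
    rw [meanHit]
    linarith

/-- Random coding, carried out one guess at a time: some list does at least as well as the average
random list. -/
lemma exists_list_sum_firstHit_le {A Ω : Type*} [Fintype A] [MeasurableSpace Ω] (μ : Measure Ω)
    [IsProbabilityMeasure μ] {B : A → Set Ω} (hB : ∀ x, MeasurableSet (B x)) (N : ℝ) (m : ℕ)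
    (p : A → ℝ) :
    ∃ L : List Ω, L.length = m ∧
      ∑ x, p x * firstHit B N L x ≤ ∑ x, p x * meanHit N (μ.real (B x)) m := by
  classical
  induction m generalizing p with
  | zero => exact ⟨[], rfl, le_rfl⟩
  | succ m ih =>
    let f : Ω → ℝ := fun y =>
      ∑ x, p x * (1 + (B x)ᶜ.indicator (fun _ => meanHit N (μ.real (B x)) m) y)
    have hi1 : ∀ x, Integrable ((B x)ᶜ.indicator fun _ => meanHit N (μ.real (B x)) m) μ := fun x =>
      (integrable_const _).indicator (hB x).compl
    have hi2 : ∀ x, Integrable (fun y =>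
        p x * (1 + (B x)ᶜ.indicator (fun _ => meanHit N (μ.real (B x)) m) y)) μ := fun x =>
      ((integrable_const 1).add (hi1 x)).const_mul _
    have hint : ∫ y, f y ∂μ = ∑ x, p x * meanHit N (μ.real (B x)) (m + 1) := by
      rw [integral_finsetSum _ fun x _ => hi2 x]
      refine Finset.sum_congr rfl fun x _ => ?_
      rw [integral_const_mul, integral_add (integrable_const 1) (hi1 x),
        integral_indicator (hB x).compl, setIntegral_const, probReal_compl_eq_one_sub (hB x)]
      simp [meanHit]
    obtain ⟨y, hy⟩ := exists_le_integral (integrable_finsetSum Finset.univ fun x _ => hi2 x)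
    change f y ≤ ∫ y, f y ∂μ at hy
    rw [hint] at hy
    obtain ⟨L, hL, hle⟩ := ih fun x => if y ∈ B x then 0 else p x
    refine ⟨y :: L, by simp [hL], le_trans ?_ hy⟩
    have h1 : ∑ x, p x * firstHit B N (y :: L) x
        = ∑ x, p x + ∑ x, (if y ∈ B x then 0 else p x) * firstHit B N L x := by
      rw [← Finset.sum_add_distrib]
      refine Finset.sum_congr rfl fun x _ => ?_
      by_cases h : y ∈ B x <;> simp [firstHit, h, mul_add]
    have h2 : f y = ∑ x, p x
        + ∑ x, (if y ∈ B x then 0 else p x) * meanHit N (μ.real (B x)) m := by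
      rw [← Finset.sum_add_distrib]
      refine Finset.sum_congr rfl fun x _ => ?_
      by_cases h : y ∈ B x <;> simp [h, mul_add]
    rw [h1, h2]
    gcongr

lemma exists_index_of_firstHit {A Ω : Type*} {B : A → Set Ω} {x : A} (L F : List Ω)
    (hF : ∃ y ∈ F, y ∈ B x) :
    ∃ j y, (L ++ F)[j]? = some y ∧ y ∈ B x ∧ ((j + 1 : ℕ) : ℝ) ≤ firstHit B F.length L x := by
  induction L with
  | nil =>
    obtain ⟨y, hy, hyB⟩ := hF
    obtain ⟨j, hj, rfl⟩ := List.getElem_of_mem hy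
    refine ⟨j, F[j], by simp [hj], hyB, ?_⟩
    simp only [firstHit]
    exact_mod_cast hj
  | cons z L ih =>
    by_cases h : z ∈ B x
    · exact ⟨0, z, by simp, h, by simp [firstHit, h]⟩
    · obtain ⟨j, y, h1, h2, h3⟩ := ih
      refine ⟨j + 1, y, by simpa using h1, h2, ?_⟩
      simp only [firstHit, h, if_false]
      push_cast at h3 ⊢
      linarith

/-- Repeated guesses can be dropped. -/
lemma exists_nodup_list {Ω : Type*} (L : List Ω) :
    ∃ L' : List Ω, L'.Nodup ∧ L'.length ≤ L.length ∧
      ∀ (j : ℕ) (y : Ω), L[j]? = some y → ∃ j', j' ≤ j ∧ L'[j']? = some y := by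
  induction L using List.reverseRecOn with
  | nil => exact ⟨[], List.nodup_nil, le_rfl, fun j y h => by simp at h⟩
  | append_singleton L z ih =>
    obtain ⟨L', hnd, hlen, hidx⟩ := ih
    by_cases hz : z ∈ L'
    · refine ⟨L', hnd, hlen.trans (by simp), fun j y h => ?_⟩
      rcases lt_or_ge j L.length with hj | hj
      · rw [List.getElem?_append_left hj] at h
        exact hidx j y h
      · rw [List.getElem?_append_right hj, List.getElem?_singleton] at h
        split_ifs at h with h0
        obtain ⟨i, hi, rfl⟩ := List.getElem_of_mem hz
        refine ⟨i, by omega, ?_⟩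
        rw [← h, List.getElem?_eq_getElem hi]
    · refine ⟨L' ++ [z], ?_, by simpa using hlen, fun j y h => ?_⟩
      · exact List.nodup_append.2 ⟨hnd, List.nodup_singleton z, by
          intro a ha b hb hab
          rw [List.mem_singleton] at hb
          exact hz (hb ▸ hab ▸ ha)⟩
      · rcases lt_or_ge j L.length with hj | hj
        · rw [List.getElem?_append_left hj] at h
          obtain ⟨j', hj', h'⟩ := hidx j y h
          refine ⟨j', hj', ?_⟩
          have hlt : j' < L'.length := by
            by_contra hge
            rw [List.getElem?_eq_none (not_lt.1 hge)] at h'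
            exact absurd h' (by simp)
          rw [List.getElem?_append_left hlt, h']
        · rw [List.getElem?_append_right hj, List.getElem?_singleton] at h
          split_ifs at h with h0
          refine ⟨L'.length, by omega, ?_⟩
          simpa using h

lemma exists_strategy_of_list {X Y : Type*} (d : X → Y → ℝ) (D : ℝ) {n : ℕ}
    (L : List (Fin n → Y)) :
    ∃ S : Strategy Y n, ∀ (x : Fin n → X) (j : ℕ) (y : Fin n → Y), L[j]? = some y →
      y ∈ distortionBall d D x → guessCount d D S x ≤ ((j + 1 : ℕ) : ℕ∞) := by
  obtain ⟨L', hnd, -, hidx⟩ := exists_nodup_list L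
  refine ⟨⟨Stream'.Seq.ofList L', fun i j y hi hj => ?_⟩, fun x j y hj hy => ?_⟩
  · rw [Stream'.Seq.ofList_get?] at hi hj
    obtain ⟨hi', hi⟩ := List.getElem?_eq_some_iff.1 hi
    obtain ⟨hj', hj⟩ := List.getElem?_eq_some_iff.1 hj
    exact (List.Nodup.getElem_inj_iff hnd).1 (hi.trans hj.symm)
  · obtain ⟨j', hj', h'⟩ := hidx j y hj
    refine (iInf₂_le j' ⟨y, by simpa using h', hy⟩).trans ?_
    exact_mod_cast Nat.succ_le_succ hj'

/-- A random sequence of law `μ` finds a sequence near `x` after `1 / μ (ball of x)` attempts on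
average; some strategy is not worse on the average over `x`, up to one additional guess. -/
lemma exists_strategy_expectedGuesses_le {X Y : Type*} [MeasurableSpace X] [MeasurableSpace Y]
    [Fintype X] [MeasurableSingletonClass X] {d : X → Y → ℝ} (hmeas : ∀ x, Measurable (d x))
    {D : ℝ} (hD : 0 ≤ D) {zero : X → Y} (hzero : ∀ x, d x (zero x) = 0)
    (P : ProbabilityMeasure X) {n : ℕ} (μ : Measure (Fin n → Y)) [IsProbabilityMeasure μ]
    (hpos : ∀ x : Fin n → X, ∏ i, mass P (x i) ≠ 0 → 0 < μ.real (distortionBall d D x)) :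
    ∃ S : Strategy Y n, expectedGuesses P d D S ≤ ENNReal.ofReal
      (∑ x : Fin n → X, (∏ i, mass P (x i)) * (1 / μ.real (distortionBall d D x)) + 1) := by
  classical
  set p : (Fin n → X) → ℝ := fun x => ∏ i, mass P (x i) with hp
  have hp0 : ∀ x, 0 ≤ p x := fun x => Finset.prod_nonneg fun i _ => mass_nonneg P _
  -- The fallback list contains an error-free reproduction of every sequence.
  let F : List (Fin n → Y) := (Finset.univ : Finset (Fin n → X)).toList.map fun x i => zero (x i)
  have hF : ∀ x : Fin n → X, ∃ y ∈ F, y ∈ distortionBall d D x := fun x =>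
    ⟨fun i => zero (x i), List.mem_map_of_mem (Finset.mem_toList.2 (Finset.mem_univ x)), by
      simp [distortionBall, meanDistortion, hzero, hD]⟩
  have hb1 : ∀ x : Fin n → X, μ.real (distortionBall d D x) ≤ 1 := fun x => measureReal_le_one
  obtain ⟨m, hm⟩ : ∃ m : ℕ,
      ∑ x, p x * (F.length * (1 - μ.real (distortionBall d D x)) ^ m) ≤ 1 := by
    have ht : Tendsto (fun m : ℕ => ∑ x, p x * (F.length *
        (1 - μ.real (distortionBall d D x)) ^ m)) atTop (nhds (∑ x : Fin n → X, 0)) := by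
      refine tendsto_finsetSum _ fun x _ => ?_
      by_cases hx : p x = 0
      · simp [hx]
      · have h1 := tendsto_pow_atTop_nhds_zero_of_lt_one
          (sub_nonneg.2 (hb1 x)) (sub_lt_self 1 (hpos x hx))
        simpa using (h1.const_mul (F.length : ℝ)).const_mul (p x)
    rw [Finset.sum_const_zero] at ht
    exact (ht.eventually_le_const zero_lt_one).exists
  obtain ⟨L, -, hL⟩ := exists_list_sum_firstHit_le μ
    (fun x : Fin n → X => measurableSet_distortionBall hmeas D x) F.length m p
  obtain ⟨S, hS⟩ := exists_strategy_of_list d D (L ++ F)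
  refine ⟨S, ?_⟩
  have h1 : ∀ x, (guessCount d D S x : ℝ≥0∞)
      ≤ ENNReal.ofReal (firstHit (fun x : Fin n → X => distortionBall d D x) F.length L x) := by
    intro x
    obtain ⟨j, y, hj, hy, hle⟩ := exists_index_of_firstHit
      (B := fun x : Fin n → X => distortionBall d D x) L F (hF x)
    have h2 : (guessCount d D S x : ℝ≥0∞) ≤ (((j + 1 : ℕ) : ℕ∞) : ℝ≥0∞) :=
      ENat.toENNReal_mono (hS x j y hj hy)
    refine h2.trans ?_
    rw [ENat.toENNReal_coe, ← ENNReal.ofReal_natCast]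
    exact ENNReal.ofReal_le_ofReal hle
  have h3 : ∀ x, 0 ≤ firstHit (fun x : Fin n → X => distortionBall d D x) F.length L x := by
    intro x
    obtain ⟨j, y, hj, hy, hle⟩ := exists_index_of_firstHit
      (B := fun x : Fin n → X => distortionBall d D x) L F (hF x)
    exact (Nat.cast_nonneg _).trans hle
  calc expectedGuesses P d D S ≤ ∑ x, ENNReal.ofReal (p x) * ENNReal.ofReal
        (firstHit (fun x : Fin n → X => distortionBall d D x) F.length L x) := by
        rw [expectedGuesses_eq_sum]
        gcongr with x
        exact h1 x
    _ = ENNReal.ofReal (∑ x, p x *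
        firstHit (fun x : Fin n → X => distortionBall d D x) F.length L x) := by
        rw [ENNReal.ofReal_sum_of_nonneg fun x _ => mul_nonneg (hp0 x) (h3 x)]
        simp_rw [ENNReal.ofReal_mul (hp0 _)]
    _ ≤ _ := by
        refine ENNReal.ofReal_le_ofReal (hL.trans ?_)
        refine le_trans ?_ (add_le_add le_rfl hm)
        rw [← Finset.sum_add_distrib]
        refine Finset.sum_le_sum fun x _ => ?_
        rw [← mul_add]
        change p x * _ ≤ p x * _
        by_cases hx : p x = 0
        · simp [hx]
        · exact mul_le_mul_of_nonneg_left (meanHit_le (hpos x hx) (hb1 x) m) (hp0 x)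

end Strategies

/-! ### Relative entropy, types, and neighbourhoods of input laws -/

section RelativeEntropy

variable {X : Type*} [Fintype X]

lemma relEntropy_eq_sub {q p : X → ℝ} (hqp : ∀ x, p x = 0 → q x = 0) :
    relEntropy q p = ∑ x, (q x * Real.log (q x) - q x * Real.log (p x)) := by
  refine Finset.sum_congr rfl fun x _ => ?_
  by_cases hq : q x = 0
  · simp [hq]
  · rw [Real.log_div hq fun hp => hq (hqp x hp)]
    ring

lemma relEntropy_self (p : X → ℝ) : relEntropy p p = 0 := by
  refine Finset.sum_eq_zero fun x _ => ?_
  by_cases hp : p x = 0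
  · simp [hp]
  · simp [div_self hp]

variable [MeasurableSpace X] [MeasurableSingletonClass X]

lemma absolutelyContinuous_iff_mass {X : Type*} [Fintype X] [MeasurableSpace X]
    (P Q : ProbabilityMeasure X) :
    (Q : Measure X) ≪ (P : Measure X) ↔ ∀ x, mass P x = 0 → mass Q x = 0 := by
  have hz : ∀ (R : ProbabilityMeasure X) x, mass R x = 0 ↔ (R : Measure X) {x} = 0 := fun R x => by
    rw [← ofReal_mass, ENNReal.ofReal_eq_zero]
    exact ⟨fun h => h.le, fun h => le_antisymm h (mass_nonneg R x)⟩
  refine ⟨fun h x hx => (hz Q x).2 (h ((hz P x).1 hx)), fun h => ?_⟩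
  intro s hs
  rw [← Set.biUnion_of_singleton s, measure_biUnion_null_iff s.to_countable] at hs ⊢
  exact fun x hx => (hz Q x).1 (h x ((hz P x).2 (hs x hx)))

lemma coe_klDiv_eq_relEntropy {P Q : ProbabilityMeasure X}
    (hQP : ∀ x, mass P x = 0 → mass Q x = 0) :
    ((klDiv (Q : Measure X) (P : Measure X) : ℝ≥0∞) : EReal) = relEntropy (mass Q) (mass P) := by
  have hac := (absolutelyContinuous_iff_mass P Q).2 hQP
  have hint : Integrable (llr (Q : Measure X) (P : Measure X)) (Q : Measure X) :=
    Integrable.of_finite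
  have hd : ∀ x, mass P x ≠ 0 →
      ((Q : Measure X).rnDeriv (P : Measure X) x).toReal = mass Q x / mass P x := by
    intro x hx
    have h1 : (Q : Measure X) {x}
        = (Q : Measure X).rnDeriv (P : Measure X) x * (P : Measure X) {x} := by
      conv_lhs => rw [← Measure.withDensity_rnDeriv_eq _ _ hac,
        withDensity_apply _ (measurableSet_singleton x)]
      rw [Measure.restrict_singleton, lintegral_smul_measure, lintegral_dirac, smul_eq_mul,
        mul_comm]
    rw [eq_div_iff hx, mass, mass, Measure.real, Measure.real, ← ENNReal.toReal_mul, ← h1]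
  have hI : ∫ x, llr (Q : Measure X) (P : Measure X) x ∂(Q : Measure X)
      = relEntropy (mass Q) (mass P) := by
    rw [integral_eq_sum_mass]
    refine Finset.sum_congr rfl fun x _ => ?_
    by_cases hx : mass P x = 0
    · simp [hQP x hx]
    · rw [llr, hd x hx]
  have h0 := integral_llr_add_sub_measure_univ_nonneg hac hint
  rw [klDiv_of_ac_of_integrable hac hint]
  simp only [probReal_univ, add_sub_cancel_right, hI] at h0 ⊢
  rw [EReal.coe_ennreal_ofReal, max_eq_left h0]

end RelativeEntropy

section Neighbourhoods

variable {X Y : Type*}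

/-- The type (empirical distribution) of the sequence `x`. -/
def letterFreq {n : ℕ} (x : Fin n → X) (a : X) : ℝ :=
  open Classical in
  (1 / (n : ℝ)) * ∑ i, if x i = a then 1 else 0

lemma letterFreq_eq_zero {n : ℕ} {x : Fin n → X} {a : X} (h : ∀ i, x i ≠ a) :
    letterFreq x a = 0 := by
  classical
  simp [letterFreq, h]

variable [Fintype X]

lemma sum_comp_eq_letterFreq {n : ℕ} (hn : 0 < n) (x : Fin n → X) (f : X → ℝ) :
    ∑ i, f (x i) = n * ∑ a, letterFreq x a * f a := by
  classical
  have hn' : (n : ℝ) ≠ 0 := by exact_mod_cast hn.ne'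
  simp_rw [letterFreq, mul_assoc, ← Finset.mul_sum]
  rw [← mul_assoc, mul_one_div_cancel hn', one_mul]
  simp_rw [Finset.sum_mul]
  rw [Finset.sum_comm]
  simp

lemma letterFreq_mem_stdSimplex {n : ℕ} (hn : 0 < n) (x : Fin n → X) :
    letterFreq x ∈ stdSimplex ℝ X := by
  classical
  refine ⟨fun a => ?_, ?_⟩
  · unfold letterFreq
    exact mul_nonneg (by positivity) (Finset.sum_nonneg fun i _ => by split_ifs <;> norm_num)
  · have h := sum_comp_eq_letterFreq hn x fun _ => 1
    have hn' : (n : ℝ) ≠ 0 := by exact_mod_cast hn.ne'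
    simp only [mul_one, Finset.sum_const, Finset.card_univ, Fintype.card_fin, nsmul_eq_mul] at h
    exact mul_left_cancel₀ hn' (by linarith)

/-- Chernoff's bound for the types in a half-space around `q`, with the exponent `D(q‖p)`. The
tilting function is the logarithmic density of a mixture of `q` and `p`, as the one of `q` itself is
not finite where `q` vanishes. -/
lemma exists_halfspace_prob_le {q p : X → ℝ} (hq : q ∈ stdSimplex ℝ X) (hp : p ∈ stdSimplex ℝ X)
    (hqp : ∀ a, p a = 0 → q a = 0) {ε : ℝ} (hε : 0 < ε) :
    ∃ h : X → ℝ, relEntropy q p - ε < ∑ a, q a * h a ∧ ∀ n : ℕ, 0 < n →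
      ∀ s : Finset (Fin n → X), (∀ x ∈ s, relEntropy q p - ε ≤ ∑ a, letterFreq x a * h a) →
        ∑ x ∈ s, ∏ i, p (x i) ≤ Real.exp (-(n * (relEntropy q p - ε))) := by
  classical
  set η := Real.exp (-(ε / 2)) with hη
  have hη0 : 0 < η := Real.exp_pos _
  have hη1 : η < 1 := Real.exp_lt_one_iff.2 (by linarith)
  set m : X → ℝ := fun a => η * q a + (1 - η) * p a with hm
  have hmpos : ∀ a, p a ≠ 0 → 0 < m a := fun a ha => by
    have h1 : 0 < p a := lt_of_le_of_ne (hp.1 a) (Ne.symm ha)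
    have h2 := hq.1 a
    have h3 : 0 < 1 - η := by linarith
    simp only [hm]
    positivity
  set h : X → ℝ := fun a => Real.log (m a / p a) with hh
  have hexp : ∀ a, p a * Real.exp (h a) = m a := by
    intro a
    by_cases ha : p a = 0
    · simp [hm, ha, hqp a ha]
    · have hpa : 0 < p a := lt_of_le_of_ne (hp.1 a) (Ne.symm ha)
      rw [hh, Real.exp_log (div_pos (hmpos a ha) hpa)]
      field_simp
  have hsum : ∑ a, p a * Real.exp (h a) = 1 := by
    simp_rw [hexp, hm]
    rw [Finset.sum_add_distrib, ← Finset.mul_sum, ← Finset.mul_sum, hq.2, hp.2]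
    ring
  refine ⟨h, ?_, fun n hn s hs => ?_⟩
  · have h1 : relEntropy q p - ε / 2 ≤ ∑ a, q a * h a := by
      have h2 : relEntropy q p - ε / 2 = ∑ a, (q a * Real.log (q a / p a) + q a * (-(ε / 2))) := by
        rw [Finset.sum_add_distrib, ← Finset.sum_mul, hq.2, relEntropy]
        ring
      rw [h2]
      refine Finset.sum_le_sum fun a _ => ?_
      by_cases ha : q a = 0
      · simp [ha]
      · have hpa' : p a ≠ 0 := fun h => ha (hqp a h)
        have hpa : 0 < p a := lt_of_le_of_ne (hp.1 a) (Ne.symm hpa')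
        have hqa : 0 < q a := lt_of_le_of_ne (hq.1 a) (Ne.symm ha)
        rw [← mul_add]
        refine mul_le_mul_of_nonneg_left ?_ hqa.le
        rw [← Real.log_exp (-(ε / 2)), ← Real.log_mul (by positivity) (Real.exp_pos _).ne', ← hη]
        refine Real.log_le_log (by positivity) ?_
        rw [div_mul_eq_mul_div]
        gcongr
        simp only [hm]
        nlinarith
    linarith
  · have h1 : ∀ x ∈ s, ∏ i, p (x i) ≤ Real.exp (-(n * (relEntropy q p - ε))) *
        ∏ i, (p (x i) * Real.exp (h (x i))) := by
      intro x hx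
      rw [Finset.prod_mul_distrib, ← Real.exp_sum, sum_comp_eq_letterFreq hn x h, mul_left_comm,
        ← Real.exp_add]
      refine le_mul_of_one_le_right (Finset.prod_nonneg fun i _ => hp.1 _) ?_
      rw [Real.one_le_exp_iff]
      have := mul_le_mul_of_nonneg_left (hs x hx) (Nat.cast_nonneg (α := ℝ) n)
      linarith
    have h2 : ∑ x ∈ s, ∏ i, (p (x i) * Real.exp (h (x i))) ≤ 1 := by
      refine (Finset.sum_le_univ_sum_of_nonneg fun x => Finset.prod_nonneg fun i _ =>
        mul_nonneg (hp.1 _) (Real.exp_pos _).le).trans (le_of_eq ?_)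
      rw [← Fintype.prod_sum (fun (_ : Fin n) a => p a * Real.exp (h a))]
      simp [hsum]
    refine (Finset.sum_le_sum h1).trans ?_
    rw [← Finset.mul_sum]
    exact mul_le_of_le_one_right (Real.exp_pos _).le h2

variable [MeasurableSpace X] [MeasurableSingletonClass X] [MeasurableSpace Y]

lemma mass_mem_stdSimplex (Q : ProbabilityMeasure X) : mass Q ∈ stdSimplex ℝ X :=
  ⟨mass_nonneg Q, sum_mass Q⟩

/-- Each input law `Q` has a neighbourhood on which the rate-distortion function is at most
`R(D, Q) + ε` and whose types can all be served by random guesses from one product law, at the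
exponential rate `R(D, Q) + ε`. -/
lemma exists_neighbourhood {d : X → Y → ℝ} {dmax D : ℝ} (hd : ∀ x y, 0 ≤ d x y ∧ d x y ≤ dmax)
    (hmeas : ∀ x, Measurable (d x)) (hD : 0 ≤ D) {zero : X → Y} (hzero : ∀ x, d x (zero x) = 0)
    (Q : ProbabilityMeasure X) {ε : ℝ} (hε : 0 < ε) :
    ∃ U : Set (X → ℝ), IsOpen U ∧ mass Q ∈ U ∧
      (∀ Q', mass Q' ∈ U →
        (rateDistortion d D Q').toReal ≤ (rateDistortion d D Q).toReal + ε) ∧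
      ∃ μ : ∀ n : ℕ, Measure (Fin n → Y), (∀ n, IsProbabilityMeasure (μ n)) ∧
        ∃ N, ∀ n ≥ N, ∀ x : Fin n → X, letterFreq x ∈ U →
          Real.exp (-(n * ((rateDistortion d D Q).toReal + ε))) / 2
            ≤ (μ n).real (distortionBall d D x) := by
  obtain ⟨T, hT, hTd⟩ := exists_testChannel hd hmeas hD hzero Q (ε := ε / 3) (by positivity)
  set R := (rateDistortion d D Q).toReal with hR
  have hR0 : 0 ≤ R := ENNReal.toReal_nonneg
  have hπ : Measurable (Sum.elim id zero : Y ⊕ X → Y) :=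
    measurable_id.sumElim Measurable.of_discrete
  set k : X → ℝ := fun a => ∫ z, T.cost a z ∂T.law a with hk
  set e : X → ℝ := fun a => ∫ z, d a (Sum.elim id zero z) ∂T.law a with he
  have hcontk : Continuous fun t : X → ℝ => ∑ a, t a * k a := by fun_prop
  have hconte : Continuous fun t : X → ℝ => ∑ a, t a * e a := by fun_prop
  obtain ⟨U₂, δ, hU₂, hQU₂, hδ, hU₂d⟩ : ∃ (U₂ : Set (X → ℝ)) (δ : ℝ), IsOpen U₂ ∧ mass Q ∈ U₂ ∧
      0 < δ ∧ ((∀ t ∈ U₂, ∑ a, t a * e a ≤ D - δ) ∨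
        ∀ a, ∀ᵐ z ∂T.law a, d a (Sum.elim id zero z) = 0) := by
    rcases hTd with h | h
    · refine ⟨{t | ∑ a, t a * e a < (D + ∑ a, mass Q a * e a) / 2},
        (D - ∑ a, mass Q a * e a) / 2, isOpen_lt hconte continuous_const, ?_, by linarith,
        Or.inl fun t ht => ?_⟩
      · show ∑ a, mass Q a * e a < (D + ∑ a, mass Q a * e a) / 2
        linarith
      · have : ∑ a, t a * e a < (D + ∑ a, mass Q a * e a) / 2 := ht
        linarith
    · exact ⟨Set.univ, 1, isOpen_univ, Set.mem_univ _, one_pos, Or.inr h⟩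
  refine ⟨{t | ∑ a, t a * k a < R + 2 * (ε / 3)} ∩ U₂,
    (isOpen_lt hcontk continuous_const).inter hU₂, ⟨?_, hQU₂⟩, fun Q' hQ' => ?_, ?_⟩
  · show ∑ a, mass Q a * k a < R + 2 * (ε / 3)
    linarith
  · have hdist : ∑ a, mass Q' a * e a ≤ D := by
      rcases hU₂d with h | h
      · have := h _ hQ'.2
        linarith
      · refine (le_of_eq (Finset.sum_eq_zero fun a _ => ?_)).trans hD
        rw [he, mul_eq_zero]
        exact Or.inr (integral_eq_zero_of_ae (h a))
    have h1 := T.rateDistortion_le hd hmeas Q' hπ hdist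
    have h2 : ∑ a, mass Q' a * k a < R + 2 * (ε / 3) := hQ'.1
    refine ENNReal.toReal_le_of_le_ofReal (by positivity)
      (h1.trans (ENNReal.ofReal_le_ofReal ?_))
    linarith
  · obtain ⟨N, hN⟩ := T.le_measure_distortionBall hd hmeas hD hπ (δ := min δ (ε / 3))
      (by positivity) (R + 2 * (ε / 3))
    have hπn : ∀ n : ℕ, Measurable fun (z : Fin n → Y ⊕ X) i => (Sum.elim id zero (z i) : Y) :=
      fun n => measurable_pi_lambda _ fun i => hπ.comp (measurable_pi_apply i)
    have hμ : ∀ n : ℕ, IsProbabilityMeasure ((Measure.pi fun _ : Fin n => T.ref).map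
        fun z i => (Sum.elim id zero (z i) : Y)) := fun n =>
      Measure.isProbabilityMeasure_map (hπn n).aemeasurable
    refine ⟨fun n => (Measure.pi fun _ : Fin n => T.ref).map fun z i => Sum.elim id zero (z i),
      hμ, max N 1, fun n hn x hx => ?_⟩
    have hn0 : 0 < n := lt_of_lt_of_le Nat.one_pos ((le_max_right _ _).trans hn)
    have hn' : (0 : ℝ) < n := by exact_mod_cast hn0
    have h1 := hN n ((le_max_left _ _).trans hn) x
      (by
        rw [sum_comp_eq_letterFreq hn0 x k]
        exact mul_le_mul_of_nonneg_left (le_of_lt hx.1) hn'.le)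
      (by
        refine hU₂d.imp (fun h => ?_) id
        rw [sum_comp_eq_letterFreq hn0 x e]
        refine mul_le_mul_of_nonneg_left ((h _ hx.2).trans ?_) hn'.le
        have := min_le_left δ (ε / 3)
        linarith)
    have := hμ n
    refine le_trans ?_ ((ENNReal.ofReal_le_iff_le_toReal (measure_ne_top _ _)).1 h1)
    have h5 : R + 2 * (ε / 3) + min δ (ε / 3) ≤ R + ε := by
      have := min_le_right δ (ε / 3)
      linarith
    exact div_le_div_of_nonneg_right (Real.exp_le_exp.2
      (neg_le_neg (mul_le_mul_of_nonneg_left h5 hn'.le))) zero_le_two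

end Neighbourhoods

/-! ### The exponent -/

section Exponent

variable {X Y : Type*} [Fintype X] [MeasurableSpace X] [MeasurableSingletonClass X]

/-- The probability law with weights `q`; if `q` is not in the simplex, `P` stands in for it. -/
def lawOf (P : ProbabilityMeasure X) (q : X → ℝ) : ProbabilityMeasure X :=
  open Classical in
  if h : q ∈ stdSimplex ℝ X then ⟨ofWeights q, isProbabilityMeasure_ofWeights h.1 h.2⟩ else P

lemma mass_lawOf (P : ProbabilityMeasure X) {q : X → ℝ} (hq : q ∈ stdSimplex ℝ X) :
    mass (lawOf P q) = q := by
  funext x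
  have h : ((lawOf P q : ProbabilityMeasure X) : Measure X) = ofWeights q := by
    simp [lawOf, hq]
  rw [mass, Measure.real, h, ofWeights_singleton, ENNReal.toReal_ofReal (hq.1 x)]

/-- The weights of the laws that are absolutely continuous with respect to the law with
weights `p`. -/
def faceOf (p : X → ℝ) : Set (X → ℝ) := {q | q ∈ stdSimplex ℝ X ∧ ∀ x, p x = 0 → q x = 0}

lemma isCompact_faceOf {X : Type*} [Fintype X] (p : X → ℝ) : IsCompact (faceOf p) := by
  have h : faceOf p = stdSimplex ℝ X ∩ ⋂ x, {q : X → ℝ | p x = 0 → q x = 0} := by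
    ext q
    simp [faceOf]
  rw [h]
  refine (isCompact_stdSimplex ℝ X).inter_right (isClosed_iInter fun x => ?_)
  by_cases hx : p x = 0
  · simpa [hx] using isClosed_eq (continuous_apply x) continuous_const
  · simp [hx]

lemma continuousOn_relEntropy {X : Type*} [Fintype X] (p : X → ℝ) :
    ContinuousOn (fun q => relEntropy q p) (faceOf p) := by
  have h : Continuous fun q : X → ℝ => ∑ x, (q x * Real.log (q x) - q x * Real.log (p x)) :=
    continuous_finsetSum _ fun x _ => (Real.continuous_mul_log.comp (continuous_apply x)).sub
      ((continuous_apply x).mul continuous_const)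
  exact h.continuousOn.congr fun q hq => relEntropy_eq_sub hq.2

lemma letterFreq_mem_faceOf {X : Type*} [Fintype X] {p : X → ℝ} {n : ℕ} (hn : 0 < n) {x : Fin n → X}
    (hx : ∏ i, p (x i) ≠ 0) : letterFreq x ∈ faceOf p :=
  ⟨letterFreq_mem_stdSimplex hn x, fun _ ha => letterFreq_eq_zero fun i hi =>
    (Finset.prod_ne_zero_iff.1 hx) i (Finset.mem_univ i) (hi ▸ ha)⟩

variable [MeasurableSpace Y]

/-- The function to be maximized, `R(D, Q) - D(Q‖P)`, in terms of the weights of `Q`. -/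
def exponentAt (P : ProbabilityMeasure X) (d : X → Y → ℝ) (D : ℝ) (q : X → ℝ) : ℝ :=
  (rateDistortion d D (lawOf P q)).toReal - relEntropy q (mass P)

section Bounds

variable {d : X → Y → ℝ} {dmax D : ℝ} (hd : ∀ x y, 0 ≤ d x y ∧ d x y ≤ dmax)
  (hmeas : ∀ x, Measurable (d x)) (hD : 0 ≤ D) {zero : X → Y} (hzero : ∀ x, d x (zero x) = 0)
  (P : ProbabilityMeasure X)

include hd hmeas hD hzero

lemma upperSemicontinuousOn_exponentAt :
    UpperSemicontinuousOn (exponentAt P d D) (faceOf (mass P)) := by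
  intro q hq y hy
  set ε := (y - exponentAt P d D q) / 2 with hε
  have hε0 : 0 < ε := by simp only [hε]; linarith
  obtain ⟨U, hU, hqU, hR, -⟩ := exists_neighbourhood hd hmeas hD hzero (lawOf P q) hε0
  rw [mass_lawOf P hq.1] at hqU
  have h1 : ∀ᶠ q' in nhdsWithin q (faceOf (mass P)),
      relEntropy q (mass P) - ε < relEntropy q' (mass P) :=
    (continuousOn_relEntropy (mass P) q hq).eventually (lt_mem_nhds (sub_lt_self _ hε0))
  filter_upwards [h1, mem_nhdsWithin_of_mem_nhds (hU.mem_nhds hqU), self_mem_nhdsWithin]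
    with q' h2 h3 h4
  have h5 := hR (lawOf P q') (by rwa [mass_lawOf P h4.1])
  have h6 : y = exponentAt P d D q + 2 * ε := by simp only [hε]; ring
  rw [h6]
  simp only [exponentAt]
  linarith

/-- The achievability part. Finitely many of the neighbourhoods provided by `exists_neighbourhood`
cover all relevant types; the guesses are drawn from the uniform mixture of the corresponding
laws. -/
lemma deceptionExponent_le {V : ℝ} (hV : ∀ q ∈ faceOf (mass P), exponentAt P d D q ≤ V) :
    deceptionExponent P d D ≤ V := by
  classical
  refine EReal.le_of_forall_lt_iff_le.1 fun v hv => ?_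
  rw [EReal.coe_lt_coe_iff] at hv
  set p := mass P with hp
  have hp0 : ∀ a, 0 ≤ p a := mass_nonneg P
  set ε := (v - V) / 3 with hε
  have hε0 : 0 < ε := by simp only [hε]; linarith
  have hpface : p ∈ faceOf p := ⟨mass_mem_stdSimplex P, fun _ h => h⟩
  have hV0 : 0 ≤ V := by
    refine le_trans ?_ (hV p hpface)
    rw [exponentAt, relEntropy_self, sub_zero]
    exact ENNReal.toReal_nonneg
  have hloc : ∀ q : X → ℝ, q ∈ faceOf p → ∃ U : Set (X → ℝ), U ∈ nhds q ∧
      ∃ μ : ∀ n : ℕ, Measure (Fin n → Y), (∀ n, IsProbabilityMeasure (μ n)) ∧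
        ∃ N : ℕ, ∀ n ≥ N,
          (∀ x : Fin n → X, letterFreq x ∈ U →
            Real.exp (-(n * ((rateDistortion d D (lawOf P q)).toReal + ε))) / 2
              ≤ (μ n).real (distortionBall d D x)) ∧
          ∑ x : Fin n → X with letterFreq x ∈ U, ∏ i, p (x i)
            ≤ Real.exp (-(n * (relEntropy q p - ε))) := by
    intro q hq
    obtain ⟨U, hU, hqU, -, μ, hμ, N, hN⟩ :=
      exists_neighbourhood hd hmeas hD hzero (lawOf P q) hε0
    rw [mass_lawOf P hq.1] at hqU
    obtain ⟨h, hqh, hh⟩ := exists_halfspace_prob_le hq.1 hpface.1 hq.2 hε0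
    have hcont : Continuous fun t : X → ℝ => ∑ a, t a * h a := by fun_prop
    refine ⟨U ∩ {t | relEntropy q p - ε < ∑ a, t a * h a},
      (hU.inter (isOpen_lt continuous_const hcont)).mem_nhds ⟨hqU, hqh⟩, μ, hμ, max N 1,
      fun n hn => ⟨fun x hx => hN n ((le_max_left _ _).trans hn) x hx.1, ?_⟩⟩
    refine hh n (lt_of_lt_of_le Nat.one_pos ((le_max_right _ _).trans hn)) _ fun x hx => ?_
    simp only [Finset.mem_filter] at hx
    exact hx.2.2.le
  choose! U hUn μ hμ N hN using hloc
  obtain ⟨s, hsK, hcover⟩ := (isCompact_faceOf p).elim_nhds_subcover U hUn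
  have hsne : s.Nonempty := by
    obtain ⟨q, hq, -⟩ := Set.mem_iUnion₂.1 (hcover hpface)
    exact ⟨q, hq⟩
  set k : ℝ := (s.card : ℝ) with hk
  have hk0 : 0 < k := by
    simp only [hk]
    exact_mod_cast hsne.card_pos
  obtain ⟨N', hN'⟩ := exists_nat_gt (Real.log (2 * k ^ 2 + 1) / ε)
  refine liminf_le_of_frequently_le' (Eventually.frequently ?_)
  filter_upwards [eventually_ge_atTop (max (s.sup N) (max N' 1))] with n hn
  have hn0 : 0 < n :=
    lt_of_lt_of_le Nat.one_pos ((le_max_right _ _).trans ((le_max_right _ _).trans hn))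
  have hnN' : N' ≤ n := (le_max_left _ _).trans ((le_max_right _ _).trans hn)
  have hnN : ∀ q ∈ s, N q ≤ n := fun q hq => (Finset.le_sup hq).trans ((le_max_left _ _).trans hn)
  have hn' : (0 : ℝ) < n := by exact_mod_cast hn0
  set ν : Measure (Fin n → Y) := ∑ q ∈ s, ENNReal.ofReal (1 / k) • μ q n with hν
  have hνp : IsProbabilityMeasure ν := by
    constructor
    rw [hν, Measure.finsetSum_apply]
    have h1 : ∀ q ∈ s, (ENNReal.ofReal (1 / k) • μ q n) Set.univ = ENNReal.ofReal (1 / k) := by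
      intro q hq
      have := hμ q (hsK q hq) n
      simp
    rw [Finset.sum_congr rfl h1, Finset.sum_const, nsmul_eq_mul, ← ENNReal.ofReal_natCast,
      ← ENNReal.ofReal_mul (Nat.cast_nonneg _), ← hk, mul_one_div_cancel hk0.ne',
      ENNReal.ofReal_one]
  have hνq : ∀ q ∈ s, ∀ A : Set (Fin n → Y), 1 / k * (μ q n).real A ≤ ν.real A := by
    intro q hq A
    have h1 : (ENNReal.ofReal (1 / k) • μ q n) A ≤ ν A :=
      Finset.single_le_sum (f := fun q => ENNReal.ofReal (1 / k) • μ q n)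
        (fun _ _ => Measure.zero_le _) hq A
    have h2 := ENNReal.toReal_mono (measure_ne_top ν A) h1
    rwa [Measure.smul_apply, smul_eq_mul, ENNReal.toReal_mul,
      ENNReal.toReal_ofReal (by positivity)] at h2
  set r : (X → ℝ) → ℝ := fun q => (rateDistortion d D (lawOf P q)).toReal + ε with hr
  have hball : ∀ q ∈ s, ∀ x : Fin n → X, letterFreq x ∈ U q →
      Real.exp (-(n * r q)) / (2 * k) ≤ ν.real (distortionBall d D x) := by
    intro q hq x hx
    refine le_trans ?_ (hνq q hq _)
    have h1 := mul_le_mul_of_nonneg_left ((hN q (hsK q hq) n (hnN q hq)).1 x hx)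
      (by positivity : 0 ≤ 1 / k)
    refine le_trans (le_of_eq ?_) h1
    simp only [hr]
    field_simp
  have hmem : ∀ x : Fin n → X, ∏ i, p (x i) ≠ 0 → ∃ q ∈ s, letterFreq x ∈ U q := by
    intro x hx
    obtain ⟨q, hq, hxq⟩ := Set.mem_iUnion₂.1 (hcover (letterFreq_mem_faceOf hn0 hx))
    exact ⟨q, hq, hxq⟩
  obtain ⟨S, hS⟩ := exists_strategy_expectedGuesses_le hmeas hD hzero P ν (fun x hx => by
    obtain ⟨q, hq, hxq⟩ := hmem x hx
    exact lt_of_lt_of_le (by positivity) (hball q hq x hxq))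
  have hsum : ∑ x : Fin n → X, (∏ i, p (x i)) * (1 / ν.real (distortionBall d D x))
      ≤ 2 * k ^ 2 * Real.exp (n * (V + 2 * ε)) := by
    have h1 : ∀ x : Fin n → X, (∏ i, p (x i)) * (1 / ν.real (distortionBall d D x))
        ≤ ∑ q ∈ s, if letterFreq x ∈ U q then
          (∏ i, p (x i)) * (2 * k * Real.exp (n * r q)) else 0 := by
      intro x
      have hpx : 0 ≤ ∏ i, p (x i) := Finset.prod_nonneg fun i _ => hp0 _
      have hnn : ∀ q ∈ s, 0 ≤ if letterFreq x ∈ U q then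
          (∏ i, p (x i)) * (2 * k * Real.exp (n * r q)) else 0 := by
        intro q _
        split_ifs <;> positivity
      by_cases hx : ∏ i, p (x i) = 0
      · exact le_trans (le_of_eq (by rw [hx, zero_mul])) (Finset.sum_nonneg hnn)
      · obtain ⟨q, hq, hxq⟩ := hmem x hx
        refine le_trans ?_ (Finset.single_le_sum hnn hq)
        rw [if_pos hxq]
        refine mul_le_mul_of_nonneg_left ?_ hpx
        refine (one_div_le_one_div_of_le (by positivity) (hball q hq x hxq)).trans (le_of_eq ?_)
        rw [one_div_div, Real.exp_neg, div_inv_eq_mul]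
    refine (Finset.sum_le_sum fun x _ => h1 x).trans ?_
    rw [Finset.sum_comm]
    have h2 : ∀ q ∈ s, (∑ x : Fin n → X, if letterFreq x ∈ U q then
        (∏ i, p (x i)) * (2 * k * Real.exp (n * r q)) else 0)
        ≤ 2 * k * Real.exp (n * (V + 2 * ε)) := by
      intro q hq
      rw [← Finset.sum_filter, ← Finset.sum_mul]
      refine (mul_le_mul_of_nonneg_right (hN q (hsK q hq) n (hnN q hq)).2
        (by positivity)).trans ?_
      rw [mul_left_comm, ← Real.exp_add]
      refine mul_le_mul_of_nonneg_left (Real.exp_le_exp.2 ?_) (by positivity)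
      have h3 := hV q (hsK q hq)
      rw [exponentAt, ← hp] at h3
      have h4 : r q - (relEntropy q p - ε) ≤ V + 2 * ε := by
        simp only [hr]
        linarith
      have h5 := mul_le_mul_of_nonneg_left h4 hn'.le
      linarith
    refine (Finset.sum_le_sum h2).trans (le_of_eq ?_)
    rw [Finset.sum_const, nsmul_eq_mul, ← hk]
    ring
  have hfinal : ∑ x : Fin n → X, (∏ i, p (x i)) * (1 / ν.real (distortionBall d D x)) + 1
      ≤ Real.exp (n * v) := by
    have h1 : 1 ≤ Real.exp (n * (V + 2 * ε)) := Real.one_le_exp (by positivity)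
    have h2 : 2 * k ^ 2 + 1 ≤ Real.exp (n * ε) := by
      rw [← Real.log_le_iff_le_exp (by positivity)]
      rw [div_lt_iff₀ hε0] at hN'
      have : (N' : ℝ) ≤ n := by exact_mod_cast hnN'
      nlinarith
    have h3 : n * v = n * ε + n * (V + 2 * ε) := by
      simp only [hε]
      ring
    rw [h3, Real.exp_add]
    have h4 := mul_le_mul_of_nonneg_right h2 (Real.exp_pos (n * (V + 2 * ε))).le
    linarith
  have hn2 : ((n : ℕ) : EReal) = ((n : ℝ) : EReal) := rfl
  rw [EReal.div_le_iff_le_mul (by rw [hn2]; exact_mod_cast hn')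
    (by rw [hn2]; exact EReal.coe_ne_top _)]
  refine (iInf_le _ S).trans ?_
  refine (ENNReal.log_monotone (hS.trans (ENNReal.ofReal_le_ofReal hfinal))).trans ?_
  rw [ENNReal.log_ofReal_of_pos (Real.exp_pos _), Real.log_exp, hn2, ← EReal.coe_mul]

omit hD hzero in
/-- The converse part. -/
lemma le_deceptionExponent [Nonempty Y] {Q : ProbabilityMeasure X}
    (hQP : ∀ x, mass P x = 0 → mass Q x = 0) :
    (((rateDistortion d D Q).toReal - relEntropy (mass Q) (mass P) : ℝ) : EReal)
      ≤ deceptionExponent P d D := by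
  refine EReal.ge_of_forall_gt_iff_ge.1 fun v hv => ?_
  rw [EReal.coe_lt_coe_iff] at hv
  set E := (rateDistortion d D Q).toReal - relEntropy (mass Q) (mass P) with hE
  set L := Real.log (Fintype.card X) with hL
  have hne : Nonempty X := nonempty_of_probabilityMeasure Q
  have hL0 : 0 ≤ L := Real.log_nonneg (by exact_mod_cast Fintype.card_pos)
  have hlim : Tendsto (fun n : ℕ => (Real.log n + Real.log (1 + L)) / n) atTop (nhds 0) := by
    have h1 := (Real.tendsto_pow_log_div_mul_add_atTop 1 0 1 one_ne_zero).comp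
      tendsto_natCast_atTop_atTop
    have h2 := tendsto_const_div_atTop_nhds_zero_nat (Real.log (1 + L))
    have h3 := h1.add h2
    simp only [add_zero] at h3
    refine h3.congr fun n => ?_
    simp [add_div]
  refine le_liminf_of_le (by isBoundedDefault) ?_
  filter_upwards [hlim.eventually_lt_const (sub_pos.2 hv), eventually_gt_atTop 0] with n hn hn0
  have hn' : (0 : ℝ) < n := by exact_mod_cast hn0
  have hn2 : ((n : ℕ) : EReal) = ((n : ℝ) : EReal) := rfl
  rw [EReal.le_div_iff_mul_le (by rw [hn2]; exact_mod_cast hn')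
    (by rw [hn2]; exact EReal.coe_ne_top _)]
  refine le_iInf fun S => le_trans ?_ (le_log_expectedGuesses hd hmeas P Q hQP hn0 S)
  rw [hn2, ← EReal.coe_mul, EReal.coe_le_coe_iff]
  have h1 : Real.log (1 + n * L) ≤ Real.log n + Real.log (1 + L) := by
    rw [← Real.log_mul hn'.ne' (by positivity)]
    refine Real.log_le_log (by positivity) ?_
    have : (1 : ℝ) ≤ n := by exact_mod_cast hn0
    nlinarith
  rw [div_lt_iff₀ hn'] at hn
  linarith

end Bounds

end Exponent

end

end Guessing

theorem theorem1 {X Y : Type*} [Finite X] [MeasurableSpace X] [MeasurableSingletonClass X]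
    [MeasurableSpace Y] (P : ProbabilityMeasure X) (d : X → Y → ℝ) (dmax : ℝ)
    (hd : ∀ x y, 0 ≤ d x y ∧ d x y ≤ dmax) (hmeas : ∀ x, Measurable (d x))
    (hzero : ∀ x, ∃ y, d x y = 0) (D : ℝ) (hD : 0 ≤ D) :
    IsGreatest
      (Set.range fun Q : ProbabilityMeasure X =>
        ((Guessing.rateDistortion d D Q : ℝ≥0∞) : EReal)
          - ((klDiv (Q : Measure X) (P : Measure X) : ℝ≥0∞) : EReal))
      (Guessing.deceptionExponent P d D) := by
  have := Fintype.ofFinite X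
  choose zero hz using hzero
  have hX : Nonempty X := Guessing.nonempty_of_probabilityMeasure P
  have hY : Nonempty Y := hX.map zero
  have hval : ∀ Q : ProbabilityMeasure X,
      (∀ x, Guessing.mass P x = 0 → Guessing.mass Q x = 0) →
      ((Guessing.rateDistortion d D Q : ℝ≥0∞) : EReal)
          - ((klDiv (Q : Measure X) (P : Measure X) : ℝ≥0∞) : EReal)
        = (((Guessing.rateDistortion d D Q).toReal
          - Guessing.relEntropy (Guessing.mass Q) (Guessing.mass P) : ℝ) : EReal) := by
    intro Q hQP
    rw [Guessing.coe_klDiv_eq_relEntropy hQP, EReal.coe_sub, EReal.coe_ennreal_toReal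
      (Guessing.rateDistortion_ne_top hd hmeas hD hz Q)]
  have hconv : ∀ Q : ProbabilityMeasure X,
      ((Guessing.rateDistortion d D Q : ℝ≥0∞) : EReal)
          - ((klDiv (Q : Measure X) (P : Measure X) : ℝ≥0∞) : EReal)
        ≤ Guessing.deceptionExponent P d D := by
    intro Q
    by_cases hQP : ∀ x, Guessing.mass P x = 0 → Guessing.mass Q x = 0
    · rw [hval Q hQP]
      exact Guessing.le_deceptionExponent hd hmeas P hQP
    · rw [klDiv_of_not_ac fun h => hQP ((Guessing.absolutelyContinuous_iff_mass P Q).1 h),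
        EReal.coe_ennreal_top, EReal.sub_top]
      exact bot_le
  have hne : (Guessing.faceOf (Guessing.mass P)).Nonempty :=
    ⟨Guessing.mass P, Guessing.mass_mem_stdSimplex P, fun _ h => h⟩
  obtain ⟨q, hq, hmax⟩ :=
    (Guessing.upperSemicontinuousOn_exponentAt hd hmeas hD hz P).exists_isMaxOn hne
      (Guessing.isCompact_faceOf (Guessing.mass P))
  have hmass := Guessing.mass_lawOf P hq.1
  refine ⟨⟨Guessing.lawOf P q, le_antisymm (hconv _) ?_⟩, ?_⟩
  · refine (Guessing.deceptionExponent_le hd hmeas hD hz P fun q' hq' => hmax hq').trans ?_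
    dsimp only
    rw [hval _ (by rw [hmass]; exact hq.2), hmass]
    exact le_rfl
  · rintro _ ⟨Q, rfl⟩
    exact hconv Q
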